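/- Write $e(x)=e^{2\pi i x}$. For $\lambda>0$ let $K(\lambda,\cdot)$ be the entire function $$K(\lambda,z)=\frac{\cos\pi z}{\pi}\sum_{n\in\mathbb Z}\frac{(-1)^n e^{-\lambda|n-1/2|}}{z-n+\tfrac12}$$ (with its removable singularities filled in), and let $\widehat K(\lambda,t)=\int_{-\infty}^{\infty}K(\lambda,x)e(-tx)\,dx$. For $x\in\mathbb R/\mathbb Z$ put $$p(\lambda,x)=-\frac2\lambda+\sum_{m\in\mathbb Z}e^{-\lambda|x+m|}.$$ Let $\mu$ be a measure on the Borel subsets of $(0,\infty)$ with $\int_0^\infty\frac{\lambda}{\lambda^2+1}\,d\mu(\lambda)<\infty$, and let $N\ge 0$ be an integer. Define $q_\mu:\mathbb R/\mathbb Z\to\mathbb R\cup\{\infty\}$ by $q_\mu(x)=\int_0^\infty p(\lambda,x)\,d\mu(\lambda)$, where only $q_\mu(0)$ may be $\infty$, and define $k_\mu(N;x)=\sum_{n=-N}^{N}\widehat k_\mu(N;n)e(nx)$, where $$\widehat k_\mu(N;0)=\int_0^\infty\Bigl\{-\frac2\lambda+\frac1{2N+2}\widehat K\Bigl(\frac{\lambda}{2N+2},0\Bigr)\Bigr\}d\mu(\lambda),\qquad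 \widehat k_\mu(N;n)=\frac1{2N+2}\int_0^\infty\widehat K\Bigl(\frac{\lambda}{2N+2},\frac{n}{2N+2}\Bigr)d\mu(\lambda)\quad(n\ne0).$$ Then $\lambda\mapsto p(\lambda,x)$ is $\mu$-integrable for every $x\neq 0$ in $\mathbb R/\mathbb Z$, $q_\mu$ is integrable on $\mathbb R/\mathbb Z$, the integral on the right of (1) below converges, and $k_\mu(N;\cdot)$ is a real valued trigonometric polynomial of degree at most $N$. Moreover: (i) For every trigonometric polynomial $\widetilde k$ (with complex coefficients) of degree at most $N$, $$\int_{\mathbb R/\mathbb Z}\bigl|q_\mu(x)-\widetilde k(x)\bigr|\,dx\ \ge\ \int_0^\infty\Bigl\{\frac2\lambda-\frac2\lambda\,\mathrm{sech}\Bigl(\frac{\lambda}{4N+4}\Bigr)\Bigr\}\,d\mu(\lambda),\tag{1}$$ with equality if and only if $\widetilde k=k_\mu(N;\cdot)$. (ii) If $\mu\neq0$, then for every $x\in\mathbb R/\mathbb Z$, $$\mathrm{sgn}\bigl(\cos\pi(2N+2)x\bigr)=\mathrm{sgn}\bigl\{q_\mu(x)-k_\mu(N;x)\bigr\}.$$ 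-/

import Mathlib

namespace PeriodicL1

open MeasureTheory
open scoped FourierTransform

noncomputable section

/-- The restriction to the real line of the entire function
`K(lam, z) = (cos (π z) / π) * ∑_{n ∈ ℤ} (-1)^n e^{-lam |n - 1/2|} / (z - n + 1/2)`,
with its removable singularities at the points `n - 1/2` filled in: note that
`(-1)^n cos (π x) / (π (x - n + 1/2)) = sinc (π (x - n + 1/2))`.
The displayed formula is `expInterp_eq` below. -/
def expInterp (lam x : ℝ) : ℝ :=
  ∑' n : ℤ, Real.exp (-lam * |(n : ℝ) - 1 / 2|) * Real.sinc (Real.pi * (x - n + 1 / 2))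

theorem expInterp_eq (lam x : ℝ) (hx : ∀ n : ℤ, x ≠ n - 1 / 2) :
    expInterp lam x = (Real.cos (Real.pi * x) / Real.pi) *
      ∑' n : ℤ, (-1 : ℝ) ^ n * Real.exp (-lam * |(n : ℝ) - 1 / 2|) / (x - n + 1 / 2) := by
  unfold expInterp
  rw [← tsum_mul_left]
  refine tsum_congr fun n => ?_
  have h1 : x - n + 1 / 2 ≠ 0 := fun h => hx n (by linarith)
  have hpi := Real.pi_ne_zero
  rw [Real.sinc_of_ne_zero (mul_ne_zero hpi h1)]
  have h2 : Real.sin (Real.pi * (x - n + 1 / 2)) = (-1 : ℝ) ^ n * Real.cos (Real.pi * x) := by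
    rw [show Real.pi * (x - n + 1 / 2) = (Real.pi * x - n * Real.pi) + Real.pi / 2 by ring,
      Real.sin_add_pi_div_two, Real.cos_sub_int_mul_pi]
  rw [h2]
  field_simp

/-- The Fourier transform `∫ K(lam, x) e^{-2 π i t x} dx` of `x ↦ K(lam, x)`. -/
def expInterpHat (lam t : ℝ) : ℂ :=
  𝓕 (fun x : ℝ => (expInterp lam x : ℂ)) t

/-- `- 2 / lam + ∑_{m ∈ ℤ} e^{-lam |x + m|}` as a function of the real variable `x`. -/
def pReal (lam x : ℝ) : ℝ :=
  -(2 / lam) + ∑' m : ℤ, Real.exp (-lam * |x + m|)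

theorem pReal_periodic (lam : ℝ) : Function.Periodic (pReal lam) 1 := by
  intro x
  unfold pReal
  congr 1
  rw [← (Equiv.addLeft (1 : ℤ)).tsum_eq (fun m : ℤ => Real.exp (-lam * |x + m|))]
  refine tsum_congr fun m => ?_
  simp [add_assoc]

/-- The function `p(lam, x)` on `ℝ / ℤ`. -/
def p (lam : ℝ) : UnitAddCircle → ℝ :=
  (pReal_periodic lam).lift

/-- The Lebesgue integral with values in `[-∞, ∞]` (integral of the positive part minus integral
of the negative part; meaningful when at least one of them is finite). -/
def extIntegral {α : Type*} [MeasurableSpace α] (μ : Measure α) (f : α → ℝ) : EReal :=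
  ((∫⁻ a, ENNReal.ofReal (f a) ∂μ : ENNReal) : EReal)
    - ((∫⁻ a, ENNReal.ofReal (-f a) ∂μ : ENNReal) : EReal)

/-- `q_μ(x) = ∫ p(lam, x) dμ(lam)`, with values in the extended reals, since the integral
at `x = 0` may be `+∞`. -/
def q (μ : Measure (Set.Ioi (0 : ℝ))) (x : UnitAddCircle) : EReal :=
  extIntegral μ (fun lam => p lam x)

/-- The Fourier coefficients of `k_μ(N; x)`. -/
def kCoeff (μ : Measure (Set.Ioi (0 : ℝ))) (N : ℕ) (n : ℤ) : ℂ :=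
  if n = 0 then
    ∫ lam : Set.Ioi (0 : ℝ), (-(2 / ((lam : ℝ) : ℂ))
      + 1 / (2 * (N : ℂ) + 2) * expInterpHat ((lam : ℝ) / (2 * N + 2)) 0) ∂μ
  else
    1 / (2 * (N : ℂ) + 2) *
      ∫ lam : Set.Ioi (0 : ℝ), expInterpHat ((lam : ℝ) / (2 * N + 2)) ((n : ℝ) / (2 * N + 2)) ∂μ

/-- `k_μ(N; x) = ∑_{n = -N}^{N} kCoeff μ N n * e^{2 π i n x}`. -/
def k (μ : Measure (Set.Ioi (0 : ℝ))) (N : ℕ) (x : UnitAddCircle) : ℂ :=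
  ∑ n ∈ Finset.Icc (-(N : ℤ)) N, kCoeff μ N n * fourier n x

/-- Trigonometric polynomials on `ℝ / ℤ` of degree at most `N`, with complex coefficients. -/
def IsTrigPoly (N : ℕ) (f : UnitAddCircle → ℂ) : Prop :=
  ∃ c : ℤ → ℂ, ∀ x, f x = ∑ n ∈ Finset.Icc (-(N : ℤ)) N, c n * fourier n x

/-- `2 / lam - (2 / lam) sech (lam / (4 N + 4))`. -/
def errorTerm (N : ℕ) (lam : ℝ) : ℝ :=
  2 / lam - 2 / lam * (1 / Real.cosh (lam / (4 * N + 4)))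

end

end PeriodicL1

/-!
Write `M = 2N + 2` and `K = expInterp`. The argument rests on the sign of the interpolation error for
a single exponential, which is then periodized and averaged over `μ`.

*One exponential on the line.* `K(lam, ·)` interpolates `e^{-lam |x|}` at the half integers. Pairing
the nodes `±(j + 1/2)` shows that `K(lam, x) = O(1 / x ^ 2)`, so `K(lam, ·)` is integrable, and Fourier
inversion identifies its transform with an explicit function `hatKernel lam` on `[-1/2, 1/2]`, and with
`0` elsewhere (`expInterpHat_eq`). The error `e^{-lam |x|} - K(lam, x)` is a positive multiple of
`cos (π x)` (`exp_sub_expInterp`). To see this, fix `x ≥ 0`, divide the error by `cos (π x)` and multiply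
it by `e^{lam x}`. The quotient tends to `0` as `lam → 0+`, and its derivative in `lam` is a positive
multiple of an alternating series, itself positive because it is, up to a factor `e^{lam x}`, a
decreasing function of `lam` with limit `0` (`tsum_alternating_div_pos`).

*Periodization.* By Poisson summation, `∑ m, K(lam / M, M (x + m))` is, up to the constant `2 / lam`, the
trigonometric polynomial `interpPoly N lam` of degree `N`. As `M` is even, `cos (π M x)` has period `1`, so
`p lam - interpPoly N lam` is a positive multiple of `cos (π M x)` (`pReal_sub_interpPoly`). The square
wave `sgn cos (π M x)` changes sign under translation by `1 / M`; hence it is orthogonal to every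
trigonometric polynomial of degree at most `N`, and its integral against `p lam` is `errorTerm N lam`.

*Averaging.* As functions of `lam`, the coefficients of `interpPoly`, the error terms, and `p lam x` for
`x` off the integers are bounded by multiples of `lam / (lam ^ 2 + 1)`; at `x = 0` the integral of
`p lam x ≥ 0` may be infinite, and then the sign of `q - k` is still that of `cos 0`. By Fubini's theorem, the integral of `q - f` against the square wave is `∫ errorTerm N lam dμ` for every
trigonometric polynomial `f` of degree at most `N`; this gives the lower bound, and equality for
`f = k`. In the case of equality `(q - f) sgn cos (π M x)` is real and nonnegative almost everywhere, so
`f = q` at the `2N + 2` sign changes of the wave, where `q` is continuous (`eq_q_of_node`). These values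
determine a trigonometric polynomial of degree at most `N` (`isTrigPoly_eq_of_node`).
-/

namespace PeriodicL1

open MeasureTheory
open scoped FourierTransform

noncomputable section

/-! ### Exponential sums over the half integers -/

theorem summable_succ_mul_exp {lam : ℝ} (h : 0 < lam) (k : ℕ) (C : ℝ) :
    Summable fun j : ℕ => C * ((j : ℝ) + 1) ^ k * Real.exp (-lam * (j + 1 / 2)) := by
  have h1 := (summable_nat_add_iff 1).2 (Real.summable_pow_mul_exp_neg_nat_mul k h)
  have h2 := h1.mul_left (C * Real.exp (lam / 2))
  refine h2.congr fun j => ?_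
  have : Real.exp (-lam * (j + 1 / 2)) =
      Real.exp (lam / 2) * Real.exp (-lam * ((j + 1 : ℕ) : ℝ)) := by
    rw [← Real.exp_add]; push_cast; ring_nf
  rw [this]; push_cast; ring

theorem summable_mul_exp {c : ℕ → ℝ} {C : ℝ} (hc : ∀ j, |c j| ≤ C * (j + 1)) {lam : ℝ}
    (h : 0 < lam) : Summable fun j : ℕ => c j * Real.exp (-lam * (j + 1 / 2)) := by
  refine Summable.of_norm_bounded (summable_succ_mul_exp h 1 C) fun j => ?_
  rw [norm_mul, Real.norm_eq_abs, Real.norm_of_nonneg (Real.exp_pos _).le, pow_one]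
  exact mul_le_mul_of_nonneg_right (hc j) (Real.exp_pos _).le

theorem abs_mul_half_le {c : ℕ → ℝ} {C : ℝ} (hc : ∀ j, |c j| ≤ C * (j + 1)) (j : ℕ) :
    |c j| * (j + 1 / 2) ≤ C * (j + 1) ^ 2 := by
  have hC : 0 ≤ C := by have := (abs_nonneg _).trans (hc 0); simpa using this
  calc |c j| * (j + 1 / 2) ≤ (C * (j + 1)) * (j + 1) := by
        gcongr
        · exact hc j
        · norm_num
    _ = C * (j + 1) ^ 2 := by ring

theorem summable_mul_half_mul_exp {c : ℕ → ℝ} {C : ℝ} (hc : ∀ j, |c j| ≤ C * (j + 1)) {lam : ℝ}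
    (h : 0 < lam) :
    Summable fun j : ℕ => -(c j * (j + 1 / 2)) * Real.exp (-lam * (j + 1 / 2)) := by
  refine Summable.of_norm_bounded (summable_succ_mul_exp h 2 C) fun j => ?_
  rw [norm_mul, norm_neg, norm_mul, Real.norm_eq_abs, Real.norm_of_nonneg (Real.exp_pos _).le,
    Real.norm_of_nonneg (by positivity : (0 : ℝ) ≤ j + 1 / 2)]
  exact mul_le_mul_of_nonneg_right (abs_mul_half_le hc j) (Real.exp_pos _).le

/-- Termwise differentiation in `lam`, the coefficients growing at most linearly. -/
theorem hasDerivAt_tsum_mul_exp {c : ℕ → ℝ} {C : ℝ} (hc : ∀ j, |c j| ≤ C * (j + 1)) {lam : ℝ}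
    (h : 0 < lam) :
    HasDerivAt (fun l => ∑' j : ℕ, c j * Real.exp (-l * (j + 1 / 2)))
      (∑' j : ℕ, -(c j * (j + 1 / 2)) * Real.exp (-lam * (j + 1 / 2))) lam := by
  have hC : 0 ≤ C := by have := (abs_nonneg _).trans (hc 0); simpa using this
  -- uniform convergence of the derivatives holds on `(lam / 2, ∞)`
  refine hasDerivAt_tsum_of_isPreconnected (t := Set.Ioi (lam / 2))
    (g := fun (j : ℕ) l => c j * Real.exp (-l * (j + 1 / 2)))
    (g' := fun (j : ℕ) l => -(c j * (j + 1 / 2)) * Real.exp (-l * (j + 1 / 2)))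
    (summable_succ_mul_exp (half_pos h) 2 C) isOpen_Ioi isPreconnected_Ioi ?_ ?_
    (Set.mem_Ioi.2 (half_lt_self h)) (summable_mul_exp hc h) (Set.mem_Ioi.2 (half_lt_self h))
  · intro j y _
    have := (((hasDerivAt_id y).neg.mul_const ((j : ℝ) + 1 / 2)).exp).const_mul (c j)
    exact this.congr_deriv (by simp; ring)
  · intro j y hy
    have hy' : lam / 2 < y := hy
    rw [norm_mul, norm_neg, norm_mul, Real.norm_eq_abs, Real.norm_of_nonneg (Real.exp_pos _).le,
      Real.norm_of_nonneg (by positivity : (0 : ℝ) ≤ j + 1 / 2)]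
    exact mul_le_mul (abs_mul_half_le hc j) (Real.exp_le_exp.2 (by gcongr)) (Real.exp_pos _).le
      (by positivity)

theorem hasSum_sech {lam : ℝ} (h : 0 < lam) :
    HasSum (fun j : ℕ => 2 * (-1) ^ j * Real.exp (-lam * (j + 1 / 2)))
      (1 / Real.cosh (lam / 2)) := by
  have hr : |-Real.exp (-lam)| < 1 := by
    rw [abs_neg, abs_of_pos (Real.exp_pos _), Real.exp_lt_one_iff]; linarith
  have h1 := (hasSum_geometric_of_abs_lt_one hr).mul_left (2 * Real.exp (-lam / 2))
  have hf : (fun j : ℕ => 2 * (-1) ^ j * Real.exp (-lam * (j + 1 / 2))) =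
      fun j : ℕ => 2 * Real.exp (-lam / 2) * (-Real.exp (-lam)) ^ j := by
    ext j
    rw [neg_pow (Real.exp (-lam)), ← Real.exp_nat_mul]
    rw [show -lam * ((j : ℝ) + 1 / 2) = (-lam / 2) + j * (-lam) by ring, Real.exp_add]
    ring
  have hv : 1 / Real.cosh (lam / 2) = 2 * Real.exp (-lam / 2) * (1 - -Real.exp (-lam))⁻¹ := by
    rw [Real.cosh_eq, show -(lam / 2) = -lam / 2 by ring]
    have e1 : Real.exp (-lam) = Real.exp (-lam / 2) * Real.exp (-lam / 2) := by
      rw [← Real.exp_add]; ring_nf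
    have e2 : Real.exp (lam / 2) = (Real.exp (-lam / 2))⁻¹ := by
      rw [← Real.exp_neg]; ring_nf
    have := Real.exp_pos (-lam / 2)
    rw [e1, e2]
    generalize Real.exp (-lam / 2) = r at *
    rw [sub_neg_eq_add]
    have h3 : (1 : ℝ) + r * r ≠ 0 := by positivity
    field_simp
  rw [hf, hv]
  exact h1

/-- The series is the derivative of `-sech (lam / 2)`. -/
theorem tsum_alternating_half_pos {lam : ℝ} (h : 0 < lam) :
    0 < ∑' j : ℕ, (-1) ^ j * (2 * ((j : ℝ) + 1 / 2)) * Real.exp (-lam * (j + 1 / 2)) := by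
  have hd := hasDerivAt_tsum_mul_exp (c := fun j => 2 * (-1) ^ j) (C := 2) (fun j => by
    rw [abs_mul, abs_pow]; simp) h
  have he : (fun l => ∑' j : ℕ, 2 * (-1) ^ j * Real.exp (-l * (j + 1 / 2))) =ᶠ[nhds lam]
      fun l => 1 / Real.cosh (l / 2) := by
    filter_upwards [lt_mem_nhds h] with l hl
    exact (hasSum_sech hl).tsum_eq
  have hd2 := (he.hasDerivAt_iff.1 hd).neg
  have hd3 : HasDerivAt (fun l : ℝ => -(1 / Real.cosh (l / 2)))
      (Real.sinh (lam / 2) * (1 / 2) / Real.cosh (lam / 2) ^ 2) lam := by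
    have h1 : HasDerivAt (fun l : ℝ => Real.cosh (l / 2)) (Real.sinh (lam / 2) * (1 / 2)) lam :=
      ((hasDerivAt_id lam).div_const 2).cosh
    have := (h1.inv (Real.cosh_pos _).ne').neg
    simp only [one_div]
    exact this.congr_deriv (by ring)
  have hE := hd2.unique hd3
  have hpos : 0 < Real.sinh (lam / 2) * (1 / 2) / Real.cosh (lam / 2) ^ 2 := by
    have := Real.sinh_pos_iff.2 (half_pos h)
    have := Real.cosh_pos (lam / 2)
    positivity
  rw [← hE, ← tsum_neg] at hpos
  exact hpos.trans_eq (tsum_congr fun j => by ring)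

/-- Positivity of `∑ (-1)^j 2 a_j / (a_j + x) e^{-lam a_j}`, `a_j = j + 1/2`: after multiplication
by `e^{-lam x}` this function of `lam` has negative derivative and limit `0` at infinity. -/
theorem tsum_alternating_div_pos {x : ℝ} (hx : 0 ≤ x) {lam : ℝ} (h : 0 < lam) :
    0 < ∑' j : ℕ, (-1) ^ j * (2 * ((j : ℝ) + 1 / 2) / (j + 1 / 2 + x)) *
      Real.exp (-lam * (j + 1 / 2)) := by
  set c : ℕ → ℝ := fun j => (-1) ^ j * (2 * ((j : ℝ) + 1 / 2) / (j + 1 / 2 + x)) with hcdef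
  have hc : ∀ j, |c j| ≤ 2 * ((j : ℝ) + 1) := by
    intro j
    have h0 : (0 : ℝ) < j + 1 / 2 + x := by positivity
    rw [hcdef]
    simp only
    rw [abs_mul, abs_pow, abs_neg, abs_one, one_pow, one_mul, abs_of_nonneg (by positivity),
      div_le_iff₀ h0]
    have : (0 : ℝ) ≤ j := by positivity
    nlinarith
  set Y : ℝ → ℝ := fun l => ∑' j : ℕ, c j * Real.exp (-l * (j + 1 / 2)) with hY
  set G : ℝ → ℝ := fun l => Real.exp (-l * x) * Y l with hG
  have hder : ∀ l, 0 < l → HasDerivAt G (Real.exp (-l * x) *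
      -∑' j : ℕ, (-1) ^ j * (2 * ((j : ℝ) + 1 / 2)) * Real.exp (-l * (j + 1 / 2))) l := by
    intro l hl
    have h1 : HasDerivAt (fun l : ℝ => Real.exp (-l * x)) (Real.exp (-l * x) * (-1 * x)) l :=
      ((hasDerivAt_id l).neg.mul_const x).exp
    have h2 := h1.fun_mul (hasDerivAt_tsum_mul_exp hc hl)
    refine h2.congr_deriv ?_
    have hs1 := summable_mul_exp hc hl
    have hs2 := summable_mul_half_mul_exp hc hl
    rw [mul_assoc, ← mul_add, ← tsum_mul_left, ← (hs1.mul_left _).tsum_add hs2, ← tsum_neg]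
    congr 1
    refine tsum_congr fun j => ?_
    have h0 : (j : ℝ) + 1 / 2 + x ≠ 0 := by positivity
    simp only [hcdef]
    field_simp
    ring
  have hanti : StrictAntiOn G (Set.Ioi 0) := by
    refine strictAntiOn_of_deriv_neg (convex_Ioi 0)
      (fun l hl => (hder l hl).continuousAt.continuousWithinAt) fun l hl => ?_
    rw [interior_Ioi] at hl
    rw [(hder l hl).deriv]
    have := mul_pos (Real.exp_pos (-l * x)) (tsum_alternating_half_pos (Set.mem_Ioi.1 hl))
    linarith
  -- `G` tends to zero at infinity: its series is bounded by `e^{-(l-1)/2}` times a constant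
  have hlim : Filter.Tendsto G Filter.atTop (nhds 0) := by
    have hs := summable_succ_mul_exp one_pos 1 2
    set B := ∑' j : ℕ, 2 * ((j : ℝ) + 1) ^ 1 * Real.exp (-1 * (j + 1 / 2)) with hB
    have hlim0 : Filter.Tendsto (fun l : ℝ => Real.exp (-(l - 1) * (1 / 2)) * B) Filter.atTop
        (nhds 0) := by
      have : Filter.Tendsto (fun l : ℝ => -(l - 1) * (1 / 2)) Filter.atTop Filter.atBot := by
        refine Filter.Tendsto.atBot_mul_const (by norm_num) ?_
        exact Filter.tendsto_neg_atTop_atBot.comp (Filter.tendsto_atTop_add_const_right _ _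
          Filter.tendsto_id)
      simpa using (Real.tendsto_exp_atBot.comp this).mul_const B
    refine squeeze_zero_norm' ?_ hlim0
    filter_upwards [Filter.eventually_ge_atTop 1] with l hl
    have hYb : ‖Y l‖ ≤ Real.exp (-(l - 1) * (1 / 2)) * B := by
      refine tsum_of_norm_bounded (hs.hasSum.mul_left _) fun j => ?_
      rw [norm_mul, Real.norm_eq_abs, Real.norm_of_nonneg (Real.exp_pos _).le, pow_one]
      calc |c j| * Real.exp (-l * (j + 1 / 2))
          ≤ (2 * (j + 1)) * (Real.exp (-(l - 1) * (1 / 2)) * Real.exp (-1 * (j + 1 / 2))) := by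
            rw [← Real.exp_add]
            gcongr
            · exact hc j
            · have : (0 : ℝ) ≤ j := by positivity
              nlinarith
        _ = _ := by ring
    rw [norm_mul, Real.norm_of_nonneg (Real.exp_pos _).le]
    refine le_trans (mul_le_of_le_one_left (norm_nonneg _) ?_) hYb
    rw [Real.exp_le_one_iff]
    nlinarith
  have hpos : 0 < G lam := by
    have h2 : 0 ≤ G (lam + 1) := by
      refine le_of_tendsto hlim ?_
      filter_upwards [Filter.eventually_ge_atTop (lam + 1)] with l hl
      exact hanti.antitoneOn (Set.mem_Ioi.2 (by linarith)) (Set.mem_Ioi.2 (by linarith)) hl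
    exact h2.trans_lt (hanti (Set.mem_Ioi.2 h) (Set.mem_Ioi.2 (by linarith)) (by linarith))
  exact (mul_pos_iff_of_pos_left (Real.exp_pos _)).1 hpos

/-! ### The interpolating function on the line and its Fourier transform -/

theorem sinc_pi_sub_half (x : ℝ) (j : ℕ) (h : x - (j + 1 / 2) ≠ 0) :
    Real.sinc (Real.pi * (x - (j + 1 / 2))) =
      -((-1) ^ j * Real.cos (Real.pi * x)) / (Real.pi * (x - (j + 1 / 2))) := by
  rw [Real.sinc_of_ne_zero (mul_ne_zero Real.pi_ne_zero h)]
  congr 1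
  rw [show Real.pi * (x - (j + 1 / 2)) = (Real.pi * x - j * Real.pi) - Real.pi / 2 by ring,
    Real.sin_sub_pi_div_two, Real.cos_sub_nat_mul_pi]

theorem sinc_pi_add_half (x : ℝ) (j : ℕ) (h : x + (j + 1 / 2) ≠ 0) :
    Real.sinc (Real.pi * (x + (j + 1 / 2))) =
      ((-1) ^ j * Real.cos (Real.pi * x)) / (Real.pi * (x + (j + 1 / 2))) := by
  rw [Real.sinc_of_ne_zero (mul_ne_zero Real.pi_ne_zero h)]
  congr 1
  rw [show Real.pi * (x + (j + 1 / 2)) = (Real.pi * x + j * Real.pi) + Real.pi / 2 by ring,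
    Real.sin_add_pi_div_two, Real.cos_add_nat_mul_pi]

/-- The sum of the two `sinc` terms of `expInterp` at the nodes `j + 1/2` and `-(j + 1/2)`. -/
def sincPair (j : ℕ) (x : ℝ) : ℝ :=
  Real.sinc (Real.pi * (x - (j + 1 / 2))) + Real.sinc (Real.pi * (x + (j + 1 / 2)))

theorem abs_sincPair_le_two (j : ℕ) (x : ℝ) : |sincPair j x| ≤ 2 := by
  have h1 := Real.abs_sinc_le_one (Real.pi * (x - (j + 1 / 2)))
  have h2 := Real.abs_sinc_le_one (Real.pi * (x + (j + 1 / 2)))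
  have := abs_add_le (Real.sinc (Real.pi * (x - (j + 1 / 2))))
    (Real.sinc (Real.pi * (x + (j + 1 / 2))))
  unfold sincPair
  linarith

theorem sincPair_eq {j : ℕ} {x : ℝ} (h1 : x - (j + 1 / 2) ≠ 0) (h2 : x + (j + 1 / 2) ≠ 0) :
    sincPair j x = Real.cos (Real.pi * x) / Real.pi *
      ((-1) ^ j * (2 * ((j : ℝ) + 1 / 2) / ((j + 1 / 2) ^ 2 - x ^ 2))) := by
  have h3 : ((j : ℝ) + 1 / 2) ^ 2 - x ^ 2 ≠ 0 := by
    rw [show ((j : ℝ) + 1 / 2) ^ 2 - x ^ 2 = -((x - (j + 1 / 2)) * (x + (j + 1 / 2))) by ring]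
    exact neg_ne_zero.2 (mul_ne_zero h1 h2)
  have hpi := Real.pi_ne_zero
  rw [sincPair, sinc_pi_sub_half x j h1, sinc_pi_add_half x j h2]
  rw [show ((j : ℝ) + 1 / 2) ^ 2 - x ^ 2 = -((x - (j + 1 / 2)) * (x + (j + 1 / 2))) by ring] at h3 ⊢
  generalize (-1 : ℝ) ^ j = s
  generalize ((j : ℝ) + 1 / 2) = a at *
  field_simp
  ring

/-- Quadratic decay: the leading terms of the two `sinc` functions cancel. -/
theorem abs_sincPair_le (j : ℕ) (x : ℝ) :
    |sincPair j x| ≤ 10 * ((j : ℝ) + 1) ^ 2 * (1 + x ^ 2)⁻¹ := by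
  have hj : (0 : ℝ) ≤ j := by positivity
  rw [← div_eq_mul_inv, le_div_iff₀ (by positivity)]
  rcases le_or_gt (x ^ 2) (4 * ((j : ℝ) + 1 / 2) ^ 2) with h | h
  · calc |sincPair j x| * (1 + x ^ 2) ≤ 2 * (1 + 4 * ((j : ℝ) + 1 / 2) ^ 2) := by
          gcongr
          exact abs_sincPair_le_two j x
      _ ≤ _ := by nlinarith
  · have h1 : x - (j + 1 / 2) ≠ 0 := by
      intro h0
      have : x = j + 1 / 2 := by linarith
      rw [this] at h; nlinarith
    have h2 : x + (j + 1 / 2) ≠ 0 := by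
      intro h0
      have : x = -(j + 1 / 2) := by linarith
      rw [this] at h; nlinarith
    rw [sincPair_eq h1 h2, abs_mul, abs_mul, abs_pow, abs_neg, abs_one, one_pow, one_mul,
      abs_div, abs_div, abs_of_pos Real.pi_pos,
      abs_of_nonneg (by positivity : (0 : ℝ) ≤ 2 * (j + 1 / 2)),
      abs_of_neg (by nlinarith : ((j : ℝ) + 1 / 2) ^ 2 - x ^ 2 < 0)]
    have hc : |Real.cos (Real.pi * x)| / Real.pi ≤ 1 := by
      rw [div_le_one Real.pi_pos]
      exact (Real.abs_cos_le_one _).trans (by linarith [Real.pi_gt_three])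
    have hd : 2 * ((j : ℝ) + 1 / 2) / -((j + 1 / 2) ^ 2 - x ^ 2) * (1 + x ^ 2) ≤
        10 * ((j : ℝ) + 1) ^ 2 := by
      rw [div_mul_eq_mul_div, div_le_iff₀ (by nlinarith)]
      nlinarith [mul_nonneg hj hj, mul_nonneg hj (sq_nonneg x),
        mul_nonneg (mul_nonneg hj hj) (by linarith : 0 ≤ x ^ 2 - 4 * ((j : ℝ) + 1 / 2) ^ 2),
        mul_nonneg hj (by linarith : 0 ≤ x ^ 2 - 4 * ((j : ℝ) + 1 / 2) ^ 2)]
    calc _ = |Real.cos (Real.pi * x)| / Real.pi *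
          (2 * ((j : ℝ) + 1 / 2) / -((j + 1 / 2) ^ 2 - x ^ 2) * (1 + x ^ 2)) := by ring
      _ ≤ 1 * (10 * ((j : ℝ) + 1) ^ 2) := by
          gcongr
          have : 0 < -(((j : ℝ) + 1 / 2) ^ 2 - x ^ 2) := by nlinarith
          positivity
      _ = _ := one_mul _

/-- The series of `expInterp` with the nodes `j + 1/2` and `-(j + 1/2)` paired. -/
theorem hasSum_expInterp {lam : ℝ} (h : 0 < lam) (x : ℝ) :
    HasSum (fun j : ℕ => Real.exp (-lam * (j + 1 / 2)) * sincPair j x) (expInterp lam x) := by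
  have hs : ∀ s : ℕ → ℝ, (∀ j, |s j| ≤ 1) →
      Summable fun j : ℕ => Real.exp (-lam * (j + 1 / 2)) * s j := by
    intro s hs
    simp_rw [mul_comm (Real.exp _)]
    refine summable_mul_exp (C := 1) (fun j => (hs j).trans ?_) h
    have : (0 : ℝ) ≤ j := by positivity
    linarith
  set f : ℤ → ℝ := fun n => Real.exp (-lam * |(n : ℝ) - 1 / 2|) *
    Real.sinc (Real.pi * (x - n + 1 / 2)) with hf
  set g : ℤ → ℝ := fun n => f (n + 1) with hg
  have e1 : ∀ j : ℕ, g j = Real.exp (-lam * (j + 1 / 2)) *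
      Real.sinc (Real.pi * (x - (j + 1 / 2))) := by
    intro j
    simp only [hg, hf]
    push_cast
    rw [show (j : ℝ) + 1 - 1 / 2 = j + 1 / 2 by ring, abs_of_nonneg (by positivity)]
    congr 3
    ring
  have e2 : ∀ j : ℕ, g (-((j : ℤ) + 1)) = Real.exp (-lam * (j + 1 / 2)) *
      Real.sinc (Real.pi * (x + (j + 1 / 2))) := by
    intro j
    simp only [hg, hf]
    push_cast
    rw [show -((j : ℝ) + 1) + 1 - 1 / 2 = -(j + 1 / 2) by ring, abs_neg,
      abs_of_nonneg (by positivity)]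
    congr 3
    ring
  have hsum : Summable g := by
    refine Summable.of_nat_of_neg_add_one ?_ ?_
    · simp_rw [e1]; exact hs _ fun j => Real.abs_sinc_le_one _
    · simp_rw [e2]; exact hs _ fun j => Real.abs_sinc_le_one _
  have htot : ∑' n, g n = expInterp lam x := (Equiv.addRight (1 : ℤ)).tsum_eq f
  have := hsum.hasSum.nat_add_neg_add_one
  rw [htot] at this
  simp_rw [e1, e2, ← mul_add] at this
  exact this

theorem expInterp_neg {lam : ℝ} (h : 0 < lam) (x : ℝ) : expInterp lam (-x) = expInterp lam x := by
  rw [← (hasSum_expInterp h x).tsum_eq, ← (hasSum_expInterp h (-x)).tsum_eq]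
  refine tsum_congr fun j => ?_
  congr 1
  rw [sincPair, sincPair, add_comm, ← Real.sinc_neg, ← Real.sinc_neg (Real.pi * (-x - _))]
  congr 2 <;> ring

theorem expInterp_abs {lam : ℝ} (h : 0 < lam) (x : ℝ) : expInterp lam |x| = expInterp lam x := by
  rcases abs_choice x with hx | hx <;> rw [hx]
  exact expInterp_neg h x

/-- Interpolation at the half integers. -/
theorem expInterp_half (lam : ℝ) (m : ℤ) :
    expInterp lam (m - 1 / 2) = Real.exp (-lam * |(m : ℝ) - 1 / 2|) := by
  rw [expInterp, tsum_eq_single m]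
  · simp
  · intro n hn
    have : (m : ℝ) - n ≠ 0 := by
      rw [sub_ne_zero]; exact_mod_cast hn.symm
    rw [show Real.pi * ((m : ℝ) - 1 / 2 - n + 1 / 2) = ((m - n : ℤ) : ℝ) * Real.pi by
      push_cast; ring,
      Real.sinc_of_ne_zero (mul_ne_zero (by push_cast; exact this) Real.pi_ne_zero),
      Real.sin_int_mul_pi]
    simp

theorem exists_abs_expInterp_le {lam : ℝ} (h : 0 < lam) :
    ∃ C : ℝ, ∀ x, |expInterp lam x| ≤ C * (1 + x ^ 2)⁻¹ := by
  have hs := summable_succ_mul_exp h 2 10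
  refine ⟨∑' j : ℕ, 10 * ((j : ℝ) + 1) ^ 2 * Real.exp (-lam * (j + 1 / 2)), fun x => ?_⟩
  rw [← (hasSum_expInterp h x).tsum_eq, ← Real.norm_eq_abs]
  refine tsum_of_norm_bounded (hs.hasSum.mul_right _) fun j => ?_
  rw [norm_mul, Real.norm_of_nonneg (Real.exp_pos _).le, Real.norm_eq_abs]
  calc _ ≤ Real.exp (-lam * (j + 1 / 2)) * (10 * ((j : ℝ) + 1) ^ 2 * (1 + x ^ 2)⁻¹) := by
        gcongr; exact abs_sincPair_le j x
    _ = _ := by ring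

theorem continuous_expInterp {lam : ℝ} (h : 0 < lam) : Continuous (expInterp lam) := by
  have : expInterp lam = fun x => ∑' j : ℕ, Real.exp (-lam * (j + 1 / 2)) * sincPair j x :=
    funext fun x => (hasSum_expInterp h x).tsum_eq.symm
  rw [this]
  refine continuous_tsum (u := fun j : ℕ => 2 * ((j : ℝ) + 1) ^ 0 * Real.exp (-lam * (j + 1 / 2)))
    (fun j => ?_) (summable_succ_mul_exp h 0 2) fun j x => ?_
  · unfold sincPair
    have := Real.continuous_sinc
    fun_prop
  · rw [norm_mul, Real.norm_of_nonneg (Real.exp_pos _).le, Real.norm_eq_abs, mul_comm]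
    have := abs_sincPair_le_two j x
    gcongr
    simpa using this

theorem integrable_expInterp {lam : ℝ} (h : 0 < lam) : Integrable (expInterp lam) := by
  obtain ⟨C, hC⟩ := exists_abs_expInterp_le h
  exact (integrable_inv_one_add_sq.const_mul C).mono' (continuous_expInterp h).aestronglyMeasurable
    (Filter.Eventually.of_forall hC)

/-- The Fourier transform of `expInterp lam` on `[-1/2, 1/2]`, in closed form. -/
def hatKernel (lam t : ℝ) : ℝ :=
  Real.sinh (lam / 2) * Real.cos (Real.pi * t) /
    (Real.sinh (lam / 2) ^ 2 + Real.sin (Real.pi * t) ^ 2)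

theorem hatKernel_neg (lam t : ℝ) : hatKernel lam (-t) = hatKernel lam t := by
  simp [hatKernel]

theorem hatKernel_half (lam : ℝ) : hatKernel lam (1 / 2) = 0 := by
  simp [hatKernel, show Real.pi * 2⁻¹ = Real.pi / 2 by ring]

theorem hatKernel_denom_pos {lam : ℝ} (h : 0 < lam) (t : ℝ) :
    0 < Real.sinh (lam / 2) ^ 2 + Real.sin (Real.pi * t) ^ 2 := by
  have := Real.sinh_pos_iff.2 (half_pos h)
  positivity

theorem continuous_hatKernel {lam : ℝ} (h : 0 < lam) : Continuous (hatKernel lam) := by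
  unfold hatKernel
  exact Continuous.div (by fun_prop) (by fun_prop) fun t => (hatKernel_denom_pos h t).ne'

/-- The Fourier series of `hatKernel` is the real part of a geometric series of ratio `w ^ 2`,
`w = e^{-lam / 2 + π i t}`. -/
theorem hasSum_hatKernel {lam : ℝ} (h : 0 < lam) (t : ℝ) :
    HasSum (fun j : ℕ => Real.exp (-lam * (j + 1 / 2)) *
      (2 * Real.cos (2 * Real.pi * t * (j + 1 / 2)))) (hatKernel lam t) := by
  set r := Real.exp (-lam / 2) with hr
  have hr0 : 0 < r := Real.exp_pos _
  have hr1 : r < 1 := by rw [hr, Real.exp_lt_one_iff]; linarith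
  set w : ℂ := Complex.exp (((-lam / 2 : ℝ) : ℂ) + ((Real.pi * t : ℝ) : ℂ) * Complex.I) with hw
  have hwn : ‖w‖ = r := by rw [hw, Complex.norm_exp]; simp [hr]
  have hw2 : ‖w ^ 2‖ < 1 := by
    rw [norm_pow, hwn]; exact pow_lt_one₀ hr0.le hr1 two_ne_zero
  have h1 := Complex.hasSum_re ((hasSum_geometric_of_norm_lt_one hw2).mul_left (2 * w))
  have hf : ∀ j : ℕ, (2 * w * (w ^ 2) ^ j).re = Real.exp (-lam * (j + 1 / 2)) *
      (2 * Real.cos (2 * Real.pi * t * (j + 1 / 2))) := by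
    intro j
    have : 2 * w * (w ^ 2) ^ j = ((2 : ℝ) : ℂ) * Complex.exp (((-lam * (j + 1 / 2) : ℝ) : ℂ) +
        ((2 * Real.pi * t * (j + 1 / 2) : ℝ) : ℂ) * Complex.I) := by
      rw [hw, mul_assoc, ← pow_mul, ← pow_succ', ← Complex.exp_nat_mul]
      push_cast
      congr 2
      ring
    rw [this, Complex.re_ofReal_mul, Complex.exp_re]
    simp
    ring
  have hwre : w.re = r * Real.cos (Real.pi * t) := by rw [hw, Complex.exp_re]; simp [hr]
  have hwim : w.im = r * Real.sin (Real.pi * t) := by rw [hw, Complex.exp_im]; simp [hr]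
  have hv : (2 * w * (1 - w ^ 2)⁻¹).re = hatKernel lam t := by
    have hsinh : Real.sinh (lam / 2) = (r⁻¹ - r) / 2 := by
      rw [Real.sinh_eq, hr, ← Real.exp_neg]; ring_nf
    have hcs := Real.sin_sq_add_cos_sq (Real.pi * t)
    have hden := hatKernel_denom_pos h t
    rw [hatKernel]
    rw [hsinh] at hden ⊢
    have hns : Complex.normSq (1 - w ^ 2) =
        4 * r ^ 2 * (((r⁻¹ - r) / 2) ^ 2 + Real.sin (Real.pi * t) ^ 2) := by
      rw [Complex.normSq_apply, pow_two w]
      simp only [Complex.sub_re, Complex.sub_im, Complex.mul_re, Complex.mul_im, Complex.one_re,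
        Complex.one_im, hwre, hwim]
      generalize Real.sin (Real.pi * t) = s at *
      generalize Real.cos (Real.pi * t) = c at *
      have : c ^ 2 = 1 - s ^ 2 := by linarith
      have h4 : c ^ 4 = (1 - s ^ 2) ^ 2 := by rw [← this]; ring
      field_simp
      ring_nf
      rw [h4, this]
      ring
    have hre : (2 * w * (1 - w ^ 2)⁻¹).re =
        2 * r * (1 - r ^ 2) * Real.cos (Real.pi * t) / Complex.normSq (1 - w ^ 2) := by
      rw [Complex.inv_def, ← mul_assoc, Complex.re_mul_ofReal, div_eq_mul_inv]
      congr 1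
      rw [pow_two w]
      simp only [Complex.mul_re, Complex.mul_im, Complex.conj_re, Complex.conj_im, Complex.sub_re,
        Complex.sub_im, Complex.one_re, Complex.one_im, hwre, hwim, Complex.re_ofNat,
        Complex.im_ofNat]
      generalize Real.sin (Real.pi * t) = s at *
      generalize Real.cos (Real.pi * t) = c at *
      have : s ^ 2 = 1 - c ^ 2 := by linarith
      ring_nf
      rw [this]
      ring
    rw [hre, hns]
    field_simp
    ring
  rw [hv] at h1
  simpa only [hf] using h1

theorem integral_cexp_half (b : ℝ) :
    ∫ t in (-(1 / 2) : ℝ)..(1 / 2), Complex.exp (((2 * Real.pi * t * b : ℝ) : ℂ) * Complex.I) =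
      (Real.sinc (Real.pi * b) : ℂ) := by
  rcases eq_or_ne b 0 with rfl | hb
  · simp; norm_num
  have h2 : 2 * Real.pi * b ≠ 0 := by positivity
  have := intervalIntegral.integral_comp_mul_right (a := -(1 / 2)) (b := 1 / 2)
    (fun s : ℝ => Complex.exp ((s : ℂ) * Complex.I)) h2
  have e : ∀ t : ℝ, 2 * Real.pi * t * b = t * (2 * Real.pi * b) := fun t => by ring
  simp_rw [e]
  rw [this, show -(1 / 2) * (2 * Real.pi * b) = -(Real.pi * b) by ring,
    show 1 / 2 * (2 * Real.pi * b) = Real.pi * b by ring, integral_exp_mul_I_eq_sinc,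
    Complex.real_smul]
  push_cast
  have : (Real.pi : ℂ) ≠ 0 := by exact_mod_cast Real.pi_ne_zero
  have : (b : ℂ) ≠ 0 := by exact_mod_cast hb
  field_simp

/-- `expInterp lam` is the inverse Fourier transform of `hatKernel lam` cut off to
`[-1/2, 1/2]`. -/
theorem integral_hatKernel_mul_cexp {lam : ℝ} (h : 0 < lam) (x : ℝ) :
    ∫ t in (-(1 / 2) : ℝ)..(1 / 2),
      (hatKernel lam t : ℂ) * Complex.exp (((2 * Real.pi * t * x : ℝ) : ℂ) * Complex.I) =
      (expInterp lam x : ℂ) := by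
  have hc : ∀ b : ℝ, Continuous fun t : ℝ =>
      Complex.exp (((2 * Real.pi * t * b : ℝ) : ℂ) * Complex.I) := fun b => by fun_prop
  have hterm : ∀ j : ℕ, ∫ t in (-(1 / 2) : ℝ)..(1 / 2),
      ((Real.exp (-lam * (j + 1 / 2)) * (2 * Real.cos (2 * Real.pi * t * (j + 1 / 2))) : ℝ) : ℂ) *
        Complex.exp (((2 * Real.pi * t * x : ℝ) : ℂ) * Complex.I) =
      ((Real.exp (-lam * (j + 1 / 2)) * sincPair j x : ℝ) : ℂ) := by
    intro j
    have e : ∀ t : ℝ, ((Real.exp (-lam * (j + 1 / 2)) *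
        (2 * Real.cos (2 * Real.pi * t * (j + 1 / 2))) : ℝ) : ℂ) *
        Complex.exp (((2 * Real.pi * t * x : ℝ) : ℂ) * Complex.I) =
        (Real.exp (-lam * (j + 1 / 2)) : ℂ) *
        (Complex.exp (((2 * Real.pi * t * (x - (j + 1 / 2)) : ℝ) : ℂ) * Complex.I) +
        Complex.exp (((2 * Real.pi * t * (x + (j + 1 / 2)) : ℝ) : ℂ) * Complex.I)) := by
      intro t
      rw [Complex.ofReal_mul, mul_assoc]
      congr 1
      rw [Complex.ofReal_mul, Complex.ofReal_cos, Complex.ofReal_ofNat, Complex.two_cos, add_mul,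
        ← Complex.exp_add, ← Complex.exp_add, add_comm]
      congr 2 <;> push_cast <;> ring
    simp_rw [e]
    rw [intervalIntegral.integral_const_mul, intervalIntegral.integral_add
      ((hc _).intervalIntegrable _ _) ((hc _).intervalIntegrable _ _), integral_cexp_half,
      integral_cexp_half, sincPair]
    push_cast
    ring
  have hsum := intervalIntegral.hasSum_integral_of_dominated_convergence
    (μ := volume) (a := -(1 / 2)) (b := 1 / 2)
    (F := fun (j : ℕ) (t : ℝ) => ((Real.exp (-lam * (j + 1 / 2)) *
      (2 * Real.cos (2 * Real.pi * t * (j + 1 / 2))) : ℝ) : ℂ) *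
        Complex.exp (((2 * Real.pi * t * x : ℝ) : ℂ) * Complex.I))
    (f := fun t => (hatKernel lam t : ℂ) *
      Complex.exp (((2 * Real.pi * t * x : ℝ) : ℂ) * Complex.I))
    (fun j _ => 2 * ((j : ℝ) + 1) ^ 0 * Real.exp (-lam * (j + 1 / 2)))
    (fun j => by fun_prop) (fun j => Filter.Eventually.of_forall fun t _ => ?_)
    (Filter.Eventually.of_forall fun t _ => summable_succ_mul_exp h 0 2)
    (by simp) (Filter.Eventually.of_forall fun t _ =>
      (Complex.hasSum_ofReal.2 (hasSum_hatKernel h t)).mul_right _)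
  · simp_rw [hterm] at hsum
    exact (hsum.unique (Complex.hasSum_ofReal.2 (hasSum_expInterp h x)))
  · rw [norm_mul, Complex.norm_exp_ofReal_mul_I, mul_one, Complex.norm_real, norm_mul,
      Real.norm_of_nonneg (Real.exp_pos _).le, Real.norm_eq_abs, abs_mul, abs_two, mul_comm]
    have := Real.abs_cos_le_one (2 * Real.pi * t * (j + 1 / 2))
    gcongr
    simpa using this

theorem integral_hatKernel_mul_cos {lam : ℝ} (h : 0 < lam) (x : ℝ) :
    ∫ t in (-(1 / 2) : ℝ)..(1 / 2), hatKernel lam t * Real.cos (2 * Real.pi * t * x) =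
      expInterp lam x := by
  have h1 := congrArg Complex.re (integral_hatKernel_mul_cexp h x)
  have hci : IntervalIntegrable (fun t : ℝ => (hatKernel lam t : ℂ) *
      Complex.exp (((2 * Real.pi * t * x : ℝ) : ℂ) * Complex.I)) volume (-(1 / 2)) (1 / 2) := by
    have := continuous_hatKernel h
    exact Continuous.intervalIntegrable (by fun_prop) _ _
  have h2 := Complex.reCLM.intervalIntegral_comp_comm hci
  simp only [Complex.reCLM_apply] at h2
  rw [← h2, Complex.ofReal_re] at h1
  rw [← h1]
  refine intervalIntegral.integral_congr fun t _ => ?_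
  rw [Complex.re_ofReal_mul, Complex.exp_ofReal_mul_I_re]

/-- Fourier inversion. The cut-off function is continuous because `hatKernel` vanishes at `±1/2`,
and its transform `expInterp` is integrable because of its quadratic decay. -/
theorem expInterpHat_eq {lam : ℝ} (h : 0 < lam) (t : ℝ) :
    expInterpHat lam t = if |t| ≤ 1 / 2 then (hatKernel lam t : ℂ) else 0 := by
  -- clamping the argument to `[-1/2, 1/2]` makes the continuity evident
  set G : ℝ → ℂ := fun t => (hatKernel lam (max (-(1 / 2)) (min t (1 / 2))) : ℂ) with hG
  have hGeq : ∀ t, G t = if |t| ≤ 1 / 2 then (hatKernel lam t : ℂ) else 0 := by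
    intro t
    simp only [hG]
    split_ifs with ht
    · rw [abs_le] at ht
      rw [min_eq_left ht.2, max_eq_right ht.1]
    · rw [abs_le, not_and_or, not_le, not_le] at ht
      rcases ht with ht | ht
      · rw [max_eq_left ((min_le_left _ _).trans ht.le), hatKernel_neg, hatKernel_half,
          Complex.ofReal_zero]
      · rw [min_eq_right ht.le, max_eq_right (by norm_num), hatKernel_half, Complex.ofReal_zero]
  have hGc : Continuous G := by
    have := continuous_hatKernel h
    fun_prop
  have hGs : HasCompactSupport G := by
    refine HasCompactSupport.intro (isCompact_Icc (a := (-(1 / 2) : ℝ)) (b := 1 / 2)) fun t ht => ?_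
    rw [hGeq, if_neg]
    rwa [abs_le]
  have hinv : 𝓕⁻ G = fun x => (expInterp lam x : ℂ) := by
    ext x
    rw [Real.fourierInv_eq', ← integral_hatKernel_mul_cexp h x, intervalIntegral.integral_of_le
      (by norm_num), ← integral_Icc_eq_integral_Ioc, ← integral_indicator measurableSet_Icc]
    congr 1
    ext t
    rw [hGeq]
    by_cases ht : |t| ≤ 1 / 2
    · rw [if_pos ht, Set.indicator_of_mem (by rwa [Set.mem_Icc, ← abs_le])]
      simp only [smul_eq_mul, RCLike.inner_apply, conj_trivial]
      rw [mul_comm]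
      congr 4
      ring
    · rw [if_neg ht, Set.indicator_of_notMem (by rwa [Set.mem_Icc, ← abs_le]), smul_zero]
  have hF : 𝓕 G = fun x => (expInterp lam x : ℂ) := by
    ext x
    have := congrFun hinv (-x)
    rw [Real.fourierInv_eq_fourier_neg, neg_neg, expInterp_neg h] at this
    exact this
  have := hGc.fourier_fourierInv_eq (hGc.integrable_of_hasCompactSupport hGs)
    (by rw [hF]; exact (integrable_expInterp h).ofReal)
  rw [hinv] at this
  rw [expInterpHat, this, hGeq]

/-- As `lam → 0+` the Fourier transform concentrates at the origin, so the dependence of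
`expInterp lam x` on `x` disappears; at the node `x = 1/2` the value is `e^{-lam / 2} → 1`. -/
theorem tendsto_expInterp_zero (x : ℝ) :
    Filter.Tendsto (fun lam => expInterp lam x) (nhdsWithin 0 (Set.Ioi 0)) (nhds 1) := by
  have hbound : ∀ lam, 0 < lam → |expInterp lam x - expInterp lam (1 / 2)| ≤
      Real.sinh (lam / 2) * (Real.pi ^ 2 * (x ^ 2 + 1 / 4) / 2) := by
    intro lam h
    have hk := continuous_hatKernel h
    rw [← integral_hatKernel_mul_cos h, ← integral_hatKernel_mul_cos h,
      ← intervalIntegral.integral_sub (Continuous.intervalIntegrable (by fun_prop) _ _)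
        (Continuous.intervalIntegrable (by fun_prop) _ _)]
    have := intervalIntegral.norm_integral_le_of_norm_le_const (a := -(1 / 2)) (b := 1 / 2)
      (f := fun t => hatKernel lam t * Real.cos (2 * Real.pi * t * x) -
        hatKernel lam t * Real.cos (2 * Real.pi * t * (1 / 2)))
      (C := Real.sinh (lam / 2) * (Real.pi ^ 2 * (x ^ 2 + 1 / 4) / 2)) fun t ht => ?_
    · rwa [show |(1 / 2 : ℝ) - -(1 / 2)| = 1 by norm_num, mul_one] at this
    rw [Set.uIoc_of_le (by norm_num)] at ht
    have hsh := Real.sinh_pos_iff.2 (half_pos h)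
    have hcos : |Real.cos (2 * Real.pi * t * x) - Real.cos (2 * Real.pi * t * (1 / 2))| ≤
        2 * Real.pi ^ 2 * t ^ 2 * (x ^ 2 + 1 / 4) := by
      have a1 := Real.one_sub_sq_div_two_le_cos (x := 2 * Real.pi * t * x)
      have a2 := Real.one_sub_sq_div_two_le_cos (x := 2 * Real.pi * t * (1 / 2))
      have a3 := Real.cos_le_one (2 * Real.pi * t * x)
      have a4 := Real.cos_le_one (2 * Real.pi * t * (1 / 2))
      have b1 : 0 ≤ Real.pi ^ 2 * t ^ 2 * x ^ 2 := by positivity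
      have b2 : 0 ≤ Real.pi ^ 2 * t ^ 2 := by positivity
      rw [abs_le]
      constructor <;> nlinarith
    have hsin : 4 * t ^ 2 ≤ Real.sin (Real.pi * t) ^ 2 := by
      have ht' : |Real.pi * t| ≤ Real.pi / 2 := by
        rw [abs_mul, abs_of_pos Real.pi_pos]
        have : |t| ≤ 1 / 2 := abs_le.2 ⟨ht.1.le, ht.2⟩
        nlinarith [Real.pi_pos]
      have := Real.mul_abs_le_abs_sin ht'
      rw [abs_mul, abs_of_pos Real.pi_pos] at this
      have h2 : 2 * |t| ≤ |Real.sin (Real.pi * t)| := by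
        convert! this using 1
        have := Real.pi_ne_zero
        field_simp
      calc 4 * t ^ 2 = (2 * |t|) ^ 2 := by rw [mul_pow, sq_abs]; norm_num
        _ ≤ |Real.sin (Real.pi * t)| ^ 2 := by gcongr
        _ = _ := sq_abs _
    have hden := hatKernel_denom_pos h t
    rw [← mul_sub, norm_mul, Real.norm_eq_abs, Real.norm_eq_abs, hatKernel, abs_div, abs_mul,
      abs_of_pos hsh, abs_of_pos hden, div_mul_eq_mul_div, div_le_iff₀ hden]
    have key : |Real.cos (Real.pi * t)| *
        |Real.cos (2 * Real.pi * t * x) - Real.cos (2 * Real.pi * t * (1 / 2))| ≤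
        Real.pi ^ 2 * (x ^ 2 + 1 / 4) / 2 *
          (Real.sinh (lam / 2) ^ 2 + Real.sin (Real.pi * t) ^ 2) :=
      calc
      _ ≤ 1 * (2 * Real.pi ^ 2 * t ^ 2 * (x ^ 2 + 1 / 4)) := by
          gcongr
          exact Real.abs_cos_le_one _
      _ = Real.pi ^ 2 * (x ^ 2 + 1 / 4) / 2 * (4 * t ^ 2) := by ring
      _ ≤ _ := by
          gcongr
          nlinarith [sq_nonneg (Real.sinh (lam / 2))]
    have := mul_le_mul_of_nonneg_left key hsh.le
    simpa only [mul_assoc] using this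
  have h0 : Filter.Tendsto (fun lam : ℝ => Real.sinh (lam / 2) *
      (Real.pi ^ 2 * (x ^ 2 + 1 / 4) / 2)) (nhdsWithin 0 (Set.Ioi 0)) (nhds 0) := by
    have : Continuous fun lam : ℝ => Real.sinh (lam / 2) *
      (Real.pi ^ 2 * (x ^ 2 + 1 / 4) / 2) := by fun_prop
    simpa using (this.tendsto 0).mono_left nhdsWithin_le_nhds
  have h1 : Filter.Tendsto (fun lam => expInterp lam x - expInterp lam (1 / 2))
      (nhdsWithin 0 (Set.Ioi 0)) (nhds 0) := by
    refine squeeze_zero_norm' ?_ h0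
    filter_upwards [self_mem_nhdsWithin] with lam hlam
    exact hbound lam hlam
  have h2 : Filter.Tendsto (fun lam => expInterp lam (1 / 2))
      (nhdsWithin 0 (Set.Ioi 0)) (nhds 1) := by
    have e : ∀ lam, expInterp lam (1 / 2) = Real.exp (-lam * (1 / 2)) := by
      intro lam
      have := expInterp_half lam 1
      norm_num at this
      norm_num [this]
    simp_rw [e]
    have : Continuous fun lam : ℝ => Real.exp (-lam * (1 / 2)) := by fun_prop
    simpa using (this.tendsto 0).mono_left nhdsWithin_le_nhds
  simpa using h1.add h2

/-! ### The sign of `e^{-lam |x|} - K(lam, x)` -/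

theorem half_sub_ne_zero {x : ℝ} (hx : Real.cos (Real.pi * x) ≠ 0) (j : ℕ) :
    x - (j + 1 / 2) ≠ 0 ∧ x + (j + 1 / 2) ≠ 0 := by
  constructor <;> intro h <;> apply hx
  · rw [show Real.pi * x = j * Real.pi + Real.pi / 2 by
      rw [show x = j + 1 / 2 by linarith]; ring, Real.cos_add_pi_div_two, Real.sin_nat_mul_pi,
      neg_zero]
  · rw [show Real.pi * x = -(j * Real.pi + Real.pi / 2) by
      rw [show x = -(j + 1 / 2) by linarith]; ring, Real.cos_neg, Real.cos_add_pi_div_two,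
      Real.sin_nat_mul_pi, neg_zero]

theorem exists_inv_half_sub_le {x : ℝ} (hx : 0 ≤ x) (hc : Real.cos (Real.pi * x) ≠ 0) :
    ∃ C : ℝ, ∀ j : ℕ, |2 * ((j : ℝ) + 1 / 2) / ((j + 1 / 2) ^ 2 - x ^ 2)| ≤ C * (j + 1) := by
  -- `|x - (j + 1/2)| ≥ |cos (π x)| / π`, because `|sinc| ≤ 1`
  have hpos : 0 < |Real.cos (Real.pi * x)| := abs_pos.2 hc
  refine ⟨2 * Real.pi / |Real.cos (Real.pi * x)|, fun j => ?_⟩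
  obtain ⟨h1, h2⟩ := half_sub_ne_zero hc j
  have hs := Real.abs_sinc_le_one (Real.pi * (x - (j + 1 / 2)))
  rw [sinc_pi_sub_half x j h1, abs_div, abs_neg, abs_mul, abs_pow, abs_neg, abs_one, one_pow,
    one_mul, abs_mul, abs_of_pos Real.pi_pos,
    div_le_one (mul_pos Real.pi_pos (abs_pos.2 h1))] at hs
  have hj : (0 : ℝ) ≤ j := by positivity
  have ha : (0 : ℝ) < j + 1 / 2 := by positivity
  have hx2 : 0 < x + (j + 1 / 2) := by positivity
  rw [show ((j : ℝ) + 1 / 2) ^ 2 - x ^ 2 = -((x - (j + 1 / 2)) * (x + (j + 1 / 2))) by ring,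
    abs_div, abs_neg, abs_mul (x - _), abs_of_pos hx2,
    abs_of_pos (by positivity : 0 < 2 * ((j : ℝ) + 1 / 2)),
    div_le_iff₀ (mul_pos (abs_pos.2 h1) hx2)]
  have h3 : 1 ≤ Real.pi / |Real.cos (Real.pi * x)| * |x - (j + 1 / 2)| := by
    rw [div_mul_eq_mul_div, one_le_div hpos]; exact hs
  have h4 : (j : ℝ) + 1 / 2 ≤ (j + 1) * (x + (j + 1 / 2)) := by nlinarith
  calc 2 * ((j : ℝ) + 1 / 2) ≤ 2 * (1 * ((j + 1) * (x + (j + 1 / 2)))) := by linarith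
    _ ≤ 2 * ((Real.pi / |Real.cos (Real.pi * x)| * |x - (j + 1 / 2)|) *
          ((j + 1) * (x + (j + 1 / 2)))) := by gcongr
    _ = _ := by ring

/-- Write `K(lam, x) = (cos (π x) / π) F(lam)` and `g(lam) = π / cos (π x) - e^{lam x} F(lam)`. Then
`g' > 0` by `tsum_alternating_div_pos`, and `g → 0` as `lam → 0+` because `K(lam, x) → 1`; hence
`g > 0`, which is the claim up to the factor `e^{-lam x} / π`. -/
theorem exp_sub_expInterp_of_nonneg {x : ℝ} (hx : 0 ≤ x) (hc : Real.cos (Real.pi * x) ≠ 0)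
    {lam : ℝ} (h : 0 < lam) :
    ∃ R : ℝ, 0 < R ∧ Real.exp (-lam * x) - expInterp lam x = Real.cos (Real.pi * x) * R := by
  obtain ⟨C, hC⟩ := exists_inv_half_sub_le hx hc
  set c : ℕ → ℝ := fun j => (-1) ^ j * (2 * ((j : ℝ) + 1 / 2) / ((j + 1 / 2) ^ 2 - x ^ 2)) with hcd
  have hcb : ∀ j, |c j| ≤ C * (j + 1) := by
    intro j
    simp only [hcd]
    rw [abs_mul, abs_pow, abs_neg, abs_one, one_pow, one_mul]
    exact hC j
  set F : ℝ → ℝ := fun l => ∑' j : ℕ, c j * Real.exp (-l * (j + 1 / 2)) with hF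
  have hK : ∀ l, 0 < l → expInterp l x = Real.cos (Real.pi * x) / Real.pi * F l := by
    intro l hl
    rw [← (hasSum_expInterp hl x).tsum_eq, hF, ← tsum_mul_left]
    refine tsum_congr fun j => ?_
    rw [sincPair_eq (half_sub_ne_zero hc j).1 (half_sub_ne_zero hc j).2]
    ring
  set g : ℝ → ℝ := fun l => Real.pi / Real.cos (Real.pi * x) - Real.exp (l * x) * F l with hg
  have hder : ∀ l, 0 < l → HasDerivAt g (Real.exp (l * x) *
      ∑' j : ℕ, (-1) ^ j * (2 * ((j : ℝ) + 1 / 2) / (j + 1 / 2 + x)) *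
      Real.exp (-l * (j + 1 / 2))) l := by
    intro l hl
    have h1 : HasDerivAt (fun l : ℝ => Real.exp (l * x)) (Real.exp (l * x) * (1 * x)) l :=
      ((hasDerivAt_id l).mul_const x).exp
    have h2 := (h1.fun_mul (hasDerivAt_tsum_mul_exp hcb hl)).const_sub
      (Real.pi / Real.cos (Real.pi * x))
    refine h2.congr_deriv ?_
    have hs1 := summable_mul_exp hcb hl
    have hs2 := summable_mul_half_mul_exp hcb hl
    rw [mul_assoc, ← mul_add, ← tsum_mul_left, ← (hs1.mul_left _).tsum_add hs2, ← mul_neg,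
      ← tsum_neg]
    congr 1
    refine tsum_congr fun j => ?_
    have h0 : (j : ℝ) + 1 / 2 + x ≠ 0 := by positivity
    have h0' := (half_sub_ne_zero hc j).1
    simp only [hcd]
    rw [show ((j : ℝ) + 1 / 2) ^ 2 - x ^ 2 = -((x - (j + 1 / 2)) * (j + 1 / 2 + x)) by ring]
    generalize (j : ℝ) + 1 / 2 = a at *
    field_simp
    ring
  have hmono : StrictMonoOn g (Set.Ioi 0) := by
    refine strictMonoOn_of_deriv_pos (convex_Ioi 0)
      (fun l hl => (hder l hl).continuousAt.continuousWithinAt) fun l hl => ?_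
    rw [interior_Ioi] at hl
    rw [(hder l hl).deriv]
    exact mul_pos (Real.exp_pos _) (tsum_alternating_div_pos hx hl)
  have hpi := Real.pi_ne_zero
  have hlim : Filter.Tendsto g (nhdsWithin 0 (Set.Ioi 0)) (nhds 0) := by
    have h1 : Filter.Tendsto (fun l : ℝ => Real.exp (l * x)) (nhdsWithin 0 (Set.Ioi 0))
        (nhds 1) := by
      have : Continuous fun l : ℝ => Real.exp (l * x) := by fun_prop
      simpa using (this.tendsto 0).mono_left nhdsWithin_le_nhds
    have h2 := ((h1.mul (tendsto_expInterp_zero x)).const_mul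
      (Real.pi / Real.cos (Real.pi * x))).const_sub (Real.pi / Real.cos (Real.pi * x))
    simp only [mul_one, sub_self] at h2
    refine h2.congr' ?_
    filter_upwards [self_mem_nhdsWithin] with l hl
    rw [hK l hl]
    simp only [hg]
    field_simp
  have hpos : 0 < g lam := by
    have h2 : 0 ≤ g (lam / 2) := by
      refine le_of_tendsto hlim ?_
      filter_upwards [Ioo_mem_nhdsGT (half_pos h)] with l hl
      exact hmono.monotoneOn (Set.mem_Ioi.2 hl.1) (Set.mem_Ioi.2 (half_pos h)) hl.2.le
    exact h2.trans_lt (hmono (Set.mem_Ioi.2 (half_pos h)) (Set.mem_Ioi.2 h) (half_lt_self h))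
  refine ⟨Real.exp (-lam * x) * g lam / Real.pi, by positivity, ?_⟩
  rw [hK lam h]
  simp only [hg]
  have he : Real.exp (-lam * x) * Real.exp (lam * x) = 1 := by
    rw [← Real.exp_add]; simp
  calc _ = Real.exp (-lam * x) - (Real.exp (-lam * x) * Real.exp (lam * x)) *
        (Real.cos (Real.pi * x) / Real.pi * F lam) := by rw [he, one_mul]
    _ = _ := by
        clear_value F
        generalize Real.cos (Real.pi * x) = cx at hc ⊢
        field_simp

/-- `e^{-lam |x|} - K(lam, x)` is a positive multiple of `cos (π x)`. -/
theorem exp_sub_expInterp {lam : ℝ} (h : 0 < lam) (x : ℝ) :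
    ∃ R : ℝ, 0 < R ∧ Real.exp (-lam * |x|) - expInterp lam x = Real.cos (Real.pi * x) * R := by
  by_cases hc : Real.cos (Real.pi * x) = 0
  · obtain ⟨k, hk⟩ := Real.cos_eq_zero_iff.1 hc
    have hx : x = ((k + 1 : ℤ) : ℝ) - 1 / 2 := by
      have := Real.pi_ne_zero
      field_simp at hk
      push_cast
      linarith
    refine ⟨1, one_pos, ?_⟩
    rw [hc, hx, expInterp_half, sub_self, zero_mul]
  · have hc' : Real.cos (Real.pi * |x|) = Real.cos (Real.pi * x) := by
      rw [← Real.cos_abs (Real.pi * x), abs_mul, abs_of_pos Real.pi_pos]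
    obtain ⟨R, hR, e⟩ := exp_sub_expInterp_of_nonneg (abs_nonneg x) (hc'.symm ▸ hc) h
    exact ⟨R, hR, by rw [← hc', ← e, expInterp_abs h]⟩

/-! ### Periodization -/

theorem exp_neg_mul_abs_le {lam : ℝ} (h : 0 < lam) (y : ℝ) :
    |Real.exp (-lam * |y|)| ≤ (1 + 2 / lam ^ 2) * (1 + y ^ 2)⁻¹ := by
  have hy := abs_nonneg y
  have h1 := Real.quadratic_le_exp_of_nonneg (mul_nonneg h.le hy)
  rw [abs_of_pos (Real.exp_pos _), neg_mul, Real.exp_neg, ← div_eq_mul_inv,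
    inv_le_comm₀ (Real.exp_pos _) (by positivity), inv_div]
  refine le_trans ?_ h1
  rw [div_le_iff₀ (by positivity), ← sq_abs y]
  generalize |y| = z at *
  have : (1 + lam * z + (lam * z) ^ 2 / 2) * (1 + 2 / lam ^ 2) =
      1 + z ^ 2 + (lam * z + (lam * z) ^ 2 / 2 + 2 / lam ^ 2 + 2 * z / lam) := by
    field_simp; ring
  rw [this]
  have : 0 ≤ lam * z + (lam * z) ^ 2 / 2 + 2 / lam ^ 2 + 2 * z / lam := by positivity
  linarith

theorem summable_of_abs_le_inv_sq {g : ℝ → ℝ} {C : ℝ} (hg : ∀ y, |g y| ≤ C * (1 + y ^ 2)⁻¹) {M : ℝ}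
    (hM : 1 ≤ M) (x : ℝ) : Summable fun m : ℤ => g (M * (x + m)) := by
  have hC : 0 ≤ C := by have := (abs_nonneg _).trans (hg 0); simpa using this
  have h0 : Summable fun m : ℤ => C * (2 * (1 + x ^ 2)) * (1 / (m : ℝ) ^ 2) :=
    (Real.summable_one_div_int_pow.2 one_lt_two).mul_left _
  refine Summable.of_norm_bounded_eventually h0 ?_
  have hne : ∀ᶠ m : ℤ in Filter.cofinite, m ≠ 0 := by
    simpa using (Set.finite_singleton (0 : ℤ)).compl_mem_cofinite
  filter_upwards [hne] with m hm
  have hm2 : 0 < (m : ℝ) ^ 2 := by positivity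
  refine (hg _).trans ?_
  rw [mul_assoc]
  gcongr
  rw [inv_eq_one_div, mul_one_div, div_le_div_iff₀ (by positivity) hm2, one_mul, mul_pow]
  have h1 : (x + m) ^ 2 ≤ M ^ 2 * (x + m) ^ 2 :=
    le_mul_of_one_le_left (sq_nonneg _) (one_le_pow₀ hM)
  have h2 : (m : ℝ) ^ 2 ≤ 2 * (x + m) ^ 2 + 2 * x ^ 2 := by nlinarith [sq_nonneg (2 * x + m)]
  nlinarith [mul_nonneg (sq_nonneg x) (sq_nonneg (M * (x + m)))]

/-- The Fourier coefficients of the trigonometric polynomial interpolating `p lam` at the zeros of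
`cos (π (2N + 2) x)`. -/
def interpCoeff (N : ℕ) (lam : ℝ) (n : ℤ) : ℝ :=
  (if n = 0 then -(2 / lam) else 0) +
    1 / (2 * N + 2) * hatKernel (lam / (2 * N + 2)) (n / (2 * N + 2))

/-- The trigonometric polynomial of degree `N` interpolating `p lam` at the zeros of
`cos (π (2N + 2) x)`. -/
def interpPoly (N : ℕ) (lam x : ℝ) : ℝ :=
  ∑ n ∈ Finset.Icc (-(N : ℤ)) N, interpCoeff N lam n * Real.cos (2 * Real.pi * n * x)

theorem interpCoeff_neg (N : ℕ) (lam : ℝ) (n : ℤ) :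
    interpCoeff N lam (-n) = interpCoeff N lam n := by
  simp only [interpCoeff, neg_eq_zero, Int.cast_neg, neg_div, hatKernel_neg]

theorem fourier_expInterp_comp_mul {lam M : ℝ} (hM : 0 < M) (t : ℝ) :
    𝓕 (fun y : ℝ => (expInterp lam (M * y) : ℂ)) t = (1 / M : ℝ) * expInterpHat lam (t / M) := by
  rw [expInterpHat, Real.fourier_real_eq, Real.fourier_real_eq]
  have := Measure.integral_comp_mul_left
    (fun v : ℝ => Real.fourierChar (-(v * (t / M))) • (expInterp lam v : ℂ)) M
  rw [abs_of_pos (inv_pos.2 hM), Complex.real_smul, inv_eq_one_div] at this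
  rw [← this]
  congr 1
  ext v
  congr 3
  field_simp

/-- For `|n| = N + 1` the argument is `±1/2`, where the transform vanishes by continuity. -/
theorem expInterpHat_div_eq_zero (N : ℕ) {lam : ℝ} (h : 0 < lam) {n : ℤ}
    (hn : n ∉ Finset.Icc (-(N : ℤ)) N) : expInterpHat lam ((n : ℝ) / (2 * N + 2)) = 0 := by
  have hM : (0 : ℝ) < 2 * N + 2 := by positivity
  rw [Finset.mem_Icc, ← abs_le, not_le] at hn
  have hn' : (N : ℝ) + 1 ≤ |(n : ℝ)| := by exact_mod_cast hn
  rw [expInterpHat_eq h]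
  split_ifs with hle
  · rw [abs_div, abs_of_pos hM, div_le_iff₀ hM] at hle
    have heq : |(n : ℝ)| = N + 1 := by linarith
    have hk : hatKernel lam ((n : ℝ) / (2 * N + 2)) = hatKernel lam (|(n : ℝ)| / (2 * N + 2)) := by
      rcases abs_choice (n : ℝ) with e | e <;> rw [e]
      rw [neg_div, hatKernel_neg]
    rw [hk, heq, show ((N : ℝ) + 1) / (2 * N + 2) = 1 / 2 by field_simp, hatKernel_half,
      Complex.ofReal_zero]
  · rfl

theorem expInterpHat_div_eq (N : ℕ) {lam : ℝ} (h : 0 < lam) {n : ℤ}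
    (hn : n ∈ Finset.Icc (-(N : ℤ)) N) :
    expInterpHat lam ((n : ℝ) / (2 * N + 2)) = (hatKernel lam ((n : ℝ) / (2 * N + 2)) : ℂ) := by
  have hM : (0 : ℝ) < 2 * N + 2 := by positivity
  rw [Finset.mem_Icc, ← abs_le] at hn
  have hn' : |(n : ℝ)| ≤ N := by exact_mod_cast hn
  rw [expInterpHat_eq h, if_pos]
  rw [abs_div, abs_of_pos hM, div_le_iff₀ hM]
  linarith

theorem fourier_coe_re (n : ℤ) (x : ℝ) :
    (fourier n (x : UnitAddCircle) : ℂ).re = Real.cos (2 * Real.pi * n * x) := by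
  rw [fourier_coe_apply, show (2 * (Real.pi : ℂ) * Complex.I * n * x / (1 : ℝ)) =
    ((2 * Real.pi * n * x : ℝ) : ℂ) * Complex.I by push_cast; ring, Complex.exp_ofReal_mul_I_re]

theorem fourier_coe_im (n : ℤ) (x : ℝ) :
    (fourier n (x : UnitAddCircle) : ℂ).im = Real.sin (2 * Real.pi * n * x) := by
  rw [fourier_coe_apply, show (2 * (Real.pi : ℂ) * Complex.I * n * x / (1 : ℝ)) =
    ((2 * Real.pi * n * x : ℝ) : ℂ) * Complex.I by push_cast; ring, Complex.exp_ofReal_mul_I_im]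

/-- Poisson summation for the dilated interpolating function. -/
theorem hasSum_expInterp_periodize (N : ℕ) {lam : ℝ} (h : 0 < lam) (x : ℝ) :
    HasSum (fun m : ℤ => expInterp (lam / (2 * N + 2)) ((2 * N + 2) * (x + m)))
      (interpPoly N lam x + 2 / lam) := by
  have hM : (0 : ℝ) < 2 * N + 2 := by positivity
  have hM1 : (1 : ℝ) ≤ 2 * N + 2 := by
    have : (0 : ℝ) ≤ N := by positivity
    linarith
  have hl : 0 < lam / (2 * N + 2) := div_pos h hM
  obtain ⟨C, hC⟩ := exists_abs_expInterp_le hl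
  have hC0 : 0 ≤ C := by have := (abs_nonneg _).trans (hC 0); simpa using this
  set f : ℝ → ℂ := fun y => (expInterp (lam / (2 * N + 2)) ((2 * N + 2) * y) : ℂ) with hf
  have hfc : Continuous f := by
    have := continuous_expInterp hl
    fun_prop
  have hO : f =O[Filter.cocompact ℝ] fun y : ℝ => |y| ^ (-(2 : ℝ)) := by
    refine Asymptotics.IsBigO.of_bound C ?_
    filter_upwards [(isCompact_singleton (x := (0 : ℝ))).compl_mem_cocompact] with y hy
    have hy0 : y ≠ 0 := hy
    have hy2 : 0 < y ^ 2 := by positivity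
    rw [hf]
    simp only
    rw [Complex.norm_real, Real.norm_eq_abs, Real.rpow_neg (abs_nonneg _), Real.rpow_two, sq_abs,
      norm_inv, Real.norm_of_nonneg hy2.le]
    refine (hC _).trans ?_
    gcongr
    rw [mul_pow]
    have : y ^ 2 ≤ (2 * N + 2) ^ 2 * y ^ 2 := le_mul_of_one_le_left hy2.le (one_le_pow₀ hM1)
    linarith
  have hFn : ∀ n : ℤ, 𝓕 f n =
      (1 / (2 * N + 2) : ℝ) * expInterpHat (lam / (2 * N + 2)) ((n : ℝ) / (2 * N + 2)) :=
    fun n => fourier_expInterp_comp_mul hM n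
  have hF0 : ∀ n ∉ Finset.Icc (-(N : ℤ)) N, 𝓕 f n = 0 := by
    intro n hn
    rw [hFn, expInterpHat_div_eq_zero N hl hn, mul_zero]
  have hP := Real.tsum_eq_tsum_fourier_of_rpow_decay_of_summable hfc one_lt_two hO
    (summable_of_ne_finset_zero hF0) x
  rw [tsum_eq_sum (f := fun n : ℤ => 𝓕 f n * fourier n (x : UnitAddCircle))
    (s := Finset.Icc (-(N : ℤ)) N) (fun n hn => by rw [hF0 n hn, zero_mul])] at hP
  have hsum : Summable fun m : ℤ => expInterp (lam / (2 * N + 2)) ((2 * N + 2) * (x + m)) :=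
    summable_of_abs_le_inv_sq hC hM1 x
  have hre := congrArg Complex.re hP
  simp only [hf] at hre
  rw [← Complex.ofReal_tsum, Complex.ofReal_re, Complex.re_sum] at hre
  have hval : ∑' m : ℤ, expInterp (lam / (2 * N + 2)) ((2 * N + 2) * (x + m)) =
      interpPoly N lam x + 2 / lam := by
    rw [hre, interpPoly]
    have e : ∀ n ∈ Finset.Icc (-(N : ℤ)) N, interpCoeff N lam n * Real.cos (2 * Real.pi * n * x) =
        (𝓕 f (n : ℝ) * fourier n (x : UnitAddCircle)).re + if n = 0 then -(2 / lam) else 0 := by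
      intro n hn
      rw [hFn, expInterpHat_div_eq N hl hn, ← Complex.ofReal_mul, Complex.re_ofReal_mul,
        fourier_coe_re, interpCoeff]
      split_ifs with h0
      · subst h0; simp; ring
      · ring
    rw [Finset.sum_congr rfl e, Finset.sum_add_distrib, Finset.sum_ite_eq', if_pos (by simp)]
    simp only [hf]
    ring
  rw [← hval]
  exact hsum.hasSum

theorem cos_pi_mul_add_int (N : ℕ) (x : ℝ) (m : ℤ) :
    Real.cos (Real.pi * ((2 * N + 2) * (x + m))) = Real.cos (Real.pi * (2 * N + 2) * x) := by
  rw [show Real.pi * ((2 * N + 2) * (x + m)) =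
    Real.pi * (2 * N + 2) * x + ((N + 1) * m : ℤ) * (2 * Real.pi) by push_cast; ring,
    Real.cos_add_int_mul_two_pi]

/-- The interpolation error is a positive multiple of `cos (π (2N + 2) x)`. -/
theorem pReal_sub_interpPoly (N : ℕ) {lam : ℝ} (h : 0 < lam) (x : ℝ) :
    ∃ R : ℝ, 0 < R ∧
      pReal lam x - interpPoly N lam x = Real.cos (Real.pi * (2 * N + 2) * x) * R := by
  have hM : (0 : ℝ) < 2 * N + 2 := by positivity
  have hl : 0 < lam / (2 * N + 2) := div_pos h hM
  have hs1 : Summable fun m : ℤ => Real.exp (-lam * |x + m|) := by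
    simpa using summable_of_abs_le_inv_sq (exp_neg_mul_abs_le h) le_rfl x
  have hs := hs1.hasSum.sub (hasSum_expInterp_periodize N h x)
  have hterm : ∀ m : ℤ, ∃ R : ℝ, 0 < R ∧ Real.exp (-lam * |x + m|) -
      expInterp (lam / (2 * N + 2)) ((2 * N + 2) * (x + m)) =
      Real.cos (Real.pi * (2 * N + 2) * x) * R := by
    intro m
    obtain ⟨R, hR, e⟩ := exp_sub_expInterp hl ((2 * N + 2) * (x + m))
    refine ⟨R, hR, ?_⟩
    rw [cos_pi_mul_add_int] at e
    rw [← e, abs_mul, abs_of_pos hM]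
    congr 2
    field_simp
  choose R hR e using hterm
  simp_rw [e] at hs
  have hval : pReal lam x - interpPoly N lam x =
      ∑' m : ℤ, Real.exp (-lam * |x + m|) - (interpPoly N lam x + 2 / lam) := by
    rw [pReal]; ring
  rw [hval]
  by_cases hc : Real.cos (Real.pi * (2 * N + 2) * x) = 0
  · refine ⟨1, one_pos, ?_⟩
    simp_rw [hc, zero_mul] at hs ⊢
    exact hs.unique hasSum_zero
  · have hsR : Summable R := (summable_mul_left_iff hc).1 hs.summable
    refine ⟨∑' m, R m, hsR.tsum_pos (fun m => (hR m).le) 0 (hR 0), ?_⟩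
    rw [← tsum_mul_left]
    exact hs.tsum_eq.symm

/-- Closed form of the periodized exponential on the fundamental domain `[0, 1]`. -/
theorem pReal_eq {lam : ℝ} (h : 0 < lam) {x : ℝ} (hx0 : 0 ≤ x) (hx1 : x ≤ 1) :
    pReal lam x = -(2 / lam) +
      (Real.exp (-lam * x) + Real.exp (-lam * (1 - x))) / (1 - Real.exp (-lam)) := by
  rw [pReal]
  congr 1
  have hr : |Real.exp (-lam)| < 1 := by
    rw [abs_of_pos (Real.exp_pos _), Real.exp_lt_one_iff]; linarith
  have hg := hasSum_geometric_of_abs_lt_one hr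
  have e1 : HasSum (fun j : ℕ => Real.exp (-lam * |x + ((j : ℤ) : ℝ)|))
      (Real.exp (-lam * x) * (1 - Real.exp (-lam))⁻¹) := by
    have e : (fun j : ℕ => Real.exp (-lam * |x + ((j : ℤ) : ℝ)|)) =
        fun j : ℕ => Real.exp (-lam * x) * Real.exp (-lam) ^ j := by
      ext j
      rw [Int.cast_natCast, abs_of_nonneg (by positivity), ← Real.exp_nat_mul, ← Real.exp_add]
      ring_nf
    rw [e]
    exact hg.mul_left _
  have e2 : HasSum (fun j : ℕ => Real.exp (-lam * |x + ((-((j : ℤ) + 1) : ℤ) : ℝ)|))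
      (Real.exp (-lam * (1 - x)) * (1 - Real.exp (-lam))⁻¹) := by
    have e : (fun j : ℕ => Real.exp (-lam * |x + ((-((j : ℤ) + 1) : ℤ) : ℝ)|)) =
        fun j : ℕ => Real.exp (-lam * (1 - x)) * Real.exp (-lam) ^ j := by
      ext j
      have hj : (0 : ℝ) ≤ j := by positivity
      push_cast
      rw [abs_of_nonpos (by linarith), ← Real.exp_nat_mul, ← Real.exp_add]
      ring_nf
    rw [e]
    exact hg.mul_left _
  rw [(HasSum.of_nat_of_neg_add_one (f := fun m : ℤ => Real.exp (-lam * |x + m|)) e1 e2).tsum_eq]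
  ring

/-! ### The square wave `sgn cos (π (2N + 2) x)` -/

/-- The square wave `sgn cos (π (2N + 2) x)`. -/
def squareWave (N : ℕ) (x : ℝ) : ℝ :=
  (SignType.sign (Real.cos (Real.pi * (2 * N + 2) * x)) : ℝ)

theorem squareWave_mul_cos (N : ℕ) (x : ℝ) :
    squareWave N x * Real.cos (Real.pi * (2 * N + 2) * x) =
      |Real.cos (Real.pi * (2 * N + 2) * x)| := by
  rw [squareWave, sign_mul_self]

theorem abs_squareWave_le_one (N : ℕ) (x : ℝ) : |squareWave N x| ≤ 1 := by
  unfold squareWave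
  rcases SignType.trichotomy (SignType.sign (Real.cos (Real.pi * (2 * N + 2) * x))) with
    h | h | h <;> simp [h]

theorem squareWave_of_pos {N : ℕ} {x : ℝ} (h : 0 < Real.cos (Real.pi * (2 * N + 2) * x)) :
    squareWave N x = 1 := by
  simp [squareWave, sign_pos h]

theorem squareWave_of_neg {N : ℕ} {x : ℝ} (h : Real.cos (Real.pi * (2 * N + 2) * x) < 0) :
    squareWave N x = -1 := by
  simp [squareWave, sign_neg h]

theorem measurable_squareWave (N : ℕ) : Measurable (squareWave N) := by
  have h : squareWave N = fun x => if 0 < Real.cos (Real.pi * (2 * N + 2) * x) then 1 else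
      if Real.cos (Real.pi * (2 * N + 2) * x) < 0 then -1 else 0 := by
    ext x
    split_ifs with h1 h2
    · exact squareWave_of_pos h1
    · exact squareWave_of_neg h2
    · have : Real.cos (Real.pi * (2 * N + 2) * x) = 0 := le_antisymm (not_lt.1 h1) (not_lt.1 h2)
      simp [squareWave, this]
  rw [h]
  exact Measurable.ite (measurableSet_lt measurable_const (by fun_prop)) measurable_const
    (Measurable.ite (measurableSet_lt (by fun_prop) measurable_const) measurable_const
      measurable_const)

theorem squareWave_antiperiodic (N : ℕ) (x : ℝ) :
    squareWave N (x + 1 / (2 * N + 2)) = -squareWave N x := by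
  have hM : (0 : ℝ) < 2 * N + 2 := by positivity
  rw [squareWave, show Real.pi * (2 * N + 2) * (x + 1 / (2 * N + 2)) =
    Real.pi * (2 * N + 2) * x + Real.pi by field_simp, Real.cos_add_pi, Left.sign_neg, squareWave]
  simp

theorem squareWave_periodic (N : ℕ) : Function.Periodic (squareWave N) 1 := by
  intro x
  have := cos_pi_mul_add_int N x 1
  rw [squareWave, squareWave, ← this]
  push_cast
  rw [mul_assoc]

theorem squareWave_one_sub (N : ℕ) (x : ℝ) : squareWave N (1 - x) = squareWave N x := by
  have h := squareWave_periodic N (-x)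
  rw [show (1 : ℝ) - x = -x + 1 by ring, h, squareWave, squareWave, mul_neg, Real.cos_neg]

theorem intervalIntegrable_squareWave (N : ℕ) (a b : ℝ) :
    IntervalIntegrable (squareWave N) volume a b := by
  refine (intervalIntegrable_const (c := (1 : ℝ))).mono_fun
    (measurable_squareWave N).aestronglyMeasurable (Filter.Eventually.of_forall fun x => ?_)
  simpa using abs_squareWave_le_one N x

theorem intervalIntegrable_squareWave_mul (N : ℕ) {g : ℝ → ℝ} (hg : Continuous g) (a b : ℝ) :
    IntervalIntegrable (fun x => squareWave N x * g x) volume a b :=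
  (intervalIntegrable_squareWave N a b).mul_continuousOn hg.continuousOn

theorem intervalIntegrable_squareWave_mul_complex (N : ℕ) {g : ℝ → ℂ} (hg : Continuous g)
    (a b : ℝ) : IntervalIntegrable (fun x => (squareWave N x : ℂ) * g x) volume a b :=
  IntervalIntegrable.mul_continuousOn ⟨(intervalIntegrable_squareWave N a b).1.ofReal,
    (intervalIntegrable_squareWave N a b).2.ofReal⟩ hg.continuousOn

/-- Orthogonality to the characters of degree at most `N`: translation by `1 / (2N + 2)` changes the
sign of the square wave and multiplies the character by a number other than `-1`. -/
theorem integral_squareWave_mul_fourier (N : ℕ) {n : ℤ} (hn : n ∈ Finset.Icc (-(N : ℤ)) N) :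
    ∫ x in (0 : ℝ)..1, (squareWave N x : ℂ) * fourier n (x : UnitAddCircle) = 0 := by
  have hM : (0 : ℝ) < 2 * N + 2 := by positivity
  set g : ℝ → ℂ := fun x => (squareWave N x : ℂ) * fourier n (x : UnitAddCircle) with hg
  have hper : Function.Periodic g 1 := by
    intro x
    simp only [hg]
    rw [squareWave_periodic N x]
    congr 2
    exact AddCircle.coe_add_period 1 x
  set z : ℂ := fourier n ((1 / (2 * N + 2) : ℝ) : UnitAddCircle) with hz
  have hshift : ∀ x, g (x + 1 / (2 * N + 2)) = -z * g x := by
    intro x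
    simp only [hg]
    have hadd : (fourier n ((x + 1 / (2 * N + 2) : ℝ) : UnitAddCircle) : ℂ) =
        fourier n (x : UnitAddCircle) * z := by
      simp only [hz, fourier_coe_apply]
      rw [← Complex.exp_add]
      congr 1
      push_cast
      ring
    rw [squareWave_antiperiodic, hadd]
    push_cast
    ring
  have h1 := intervalIntegral.integral_comp_add_right (a := 0) (b := 1) g (1 / (2 * N + 2))
  have h2 := hper.intervalIntegral_add_eq (0 + 1 / (2 * N + 2)) 0
  simp_rw [hshift] at h1
  rw [intervalIntegral.integral_const_mul, show (1 : ℝ) + 1 / (2 * N + 2) =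
    0 + 1 / (2 * N + 2) + 1 by ring, h2, zero_add] at h1
  have hz1 : 1 + z ≠ 0 := by
    intro h0
    have hre := congrArg Complex.re h0
    rw [Complex.add_re, Complex.one_re, hz, fourier_coe_re, Complex.zero_re,
      ← Real.cos_abs] at hre
    rw [Finset.mem_Icc, ← abs_le] at hn
    have hn' : |(n : ℝ)| ≤ N := by exact_mod_cast hn
    have hlt : |2 * Real.pi * n * (1 / (2 * N + 2))| < Real.pi := by
      rw [abs_mul, abs_mul, abs_of_pos (by positivity : 0 < 2 * Real.pi),
        abs_of_pos (by positivity : (0 : ℝ) < 1 / (2 * N + 2)), mul_one_div, div_lt_iff₀ hM]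
      nlinarith [Real.pi_pos]
    have := Real.cos_lt_cos_of_nonneg_of_le_pi (abs_nonneg _) le_rfl hlt
    rw [Real.cos_pi] at this
    linarith
  have : (1 + z) * ∫ x in (0 : ℝ)..1, g x = 0 := by linear_combination -h1
  exact (mul_eq_zero.1 this).resolve_left hz1

theorem integral_squareWave_mul_trigPoly (N : ℕ) {f : UnitAddCircle → ℂ} (hf : IsTrigPoly N f) :
    ∫ x in (0 : ℝ)..1, (squareWave N x : ℂ) * f (x : UnitAddCircle) = 0 := by
  obtain ⟨c, hc⟩ := hf
  simp_rw [hc, Finset.mul_sum]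
  have hcont : ∀ n : ℤ, Continuous fun x : ℝ => fourier n (x : UnitAddCircle) := fun n =>
    (fourier n).continuous.comp (AddCircle.continuous_mk' 1)
  rw [intervalIntegral.integral_finsetSum fun n _ =>
    intervalIntegrable_squareWave_mul_complex N (g := fun x => c n * fourier n (x : UnitAddCircle))
      (continuous_const.mul (hcont n)) _ _]
  refine Finset.sum_eq_zero fun n hn => ?_
  simp_rw [mul_left_comm _ (c n)]
  rw [intervalIntegral.integral_const_mul, integral_squareWave_mul_fourier N hn, mul_zero]

theorem integral_squareWave (N : ℕ) : ∫ x in (0 : ℝ)..1, squareWave N x = 0 := by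
  have h := integral_squareWave_mul_fourier N (n := 0) (by simp)
  simp only [fourier_zero, mul_one] at h
  rw [intervalIntegral.integral_ofReal] at h
  exact_mod_cast h

theorem integral_exp_neg_mul {lam : ℝ} (h : 0 < lam) (a b : ℝ) :
    ∫ x in a..b, Real.exp (-lam * x) = (Real.exp (-lam * a) - Real.exp (-lam * b)) / lam := by
  rw [intervalIntegral.integral_comp_mul_left (fun x => Real.exp x) (neg_ne_zero.2 h.ne'),
    integral_exp, smul_eq_mul]
  field_simp
  ring

/-- Both `squareWave` and the exponential are multiplied by a constant under translation by half a
period of the wave, so the integral reduces to the one over a single half period. -/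
theorem integral_squareWave_mul_exp (N : ℕ) {lam : ℝ} (h : 0 < lam) :
    ∫ x in (0 : ℝ)..1, squareWave N x * Real.exp (-lam * x) =
      (1 - Real.exp (-lam)) * ((1 - Real.exp (-(lam / (4 * N + 4)))) ^ 2 / lam) /
        (1 + Real.exp (-(lam / (4 * N + 4))) ^ 2) := by
  have hM : (0 : ℝ) < 2 * N + 2 := by positivity
  set d : ℝ := 1 / (2 * N + 2) with hd
  have hd0 : 0 < d := by positivity
  set g : ℝ → ℝ := fun x => squareWave N x * Real.exp (-lam * x) with hg
  have hgi : ∀ a b, IntervalIntegrable g volume a b := fun a b =>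
    intervalIntegrable_squareWave_mul N (by fun_prop) a b
  set r := Real.exp (-(lam / (4 * N + 4))) with hr
  have hr2 : Real.exp (-lam * d) = r ^ 2 := by
    rw [hr, ← Real.exp_nat_mul, hd]
    congr 1
    push_cast
    field_simp
    ring
  have hr1 : Real.exp (-lam * (d / 2)) = r := by
    rw [hr, hd]
    congr 1
    field_simp
    ring
  -- the wave has period `2 d`; this is the integral over half a period
  have hV : ∫ x in (0 : ℝ)..d, g x = (1 - r) ^ 2 / lam := by
    have hMd : (2 * N + 2) * d = 1 := by rw [hd]; field_simp
    have h1 : ∫ x in (0 : ℝ)..(d / 2), g x = ∫ x in (0 : ℝ)..(d / 2), Real.exp (-lam * x) := by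
      refine intervalIntegral.integral_congr_ae ?_
      have hne : ∀ᵐ x : ℝ, x ≠ d / 2 := by simp [ae_iff, measure_singleton]
      filter_upwards [hne] with x hx hxm
      rw [Set.uIoc_of_le (by positivity)] at hxm
      have hlt : x < d / 2 := lt_of_le_of_ne hxm.2 hx
      have : squareWave N x = 1 := by
        refine squareWave_of_pos (Real.cos_pos_of_mem_Ioo ⟨?_, ?_⟩)
        · have := hxm.1
          have : 0 < Real.pi * (2 * N + 2) * x := by positivity
          linarith [Real.pi_pos]
        · have : (2 * N + 2) * x < 1 / 2 := by nlinarith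
          nlinarith [Real.pi_pos]
      simp only [hg]
      rw [this, one_mul]
    have h2 : ∫ x in (d / 2)..d, g x = ∫ x in (d / 2)..d, -Real.exp (-lam * x) := by
      refine intervalIntegral.integral_congr_ae (Filter.Eventually.of_forall fun x hxm => ?_)
      rw [Set.uIoc_of_le (by linarith)] at hxm
      have : squareWave N x = -1 := by
        refine squareWave_of_neg (Real.cos_neg_of_pi_div_two_lt_of_lt ?_ ?_)
        · have : 1 / 2 < (2 * N + 2) * x := by nlinarith [hxm.1]
          nlinarith [Real.pi_pos]
        · have : (2 * N + 2) * x ≤ 1 := by nlinarith [hxm.2]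
          nlinarith [Real.pi_pos]
      simp only [hg]
      rw [this, neg_one_mul]
    rw [← intervalIntegral.integral_add_adjacent_intervals (hgi 0 (d / 2)) (hgi (d / 2) d), h1, h2,
      intervalIntegral.integral_neg, integral_exp_neg_mul h, integral_exp_neg_mul h, hr1, hr2,
      mul_zero, Real.exp_zero]
    ring
  -- the integral over `[d, 1 + d]`, computed by translation and by splitting at `1`
  have hsh : ∫ x in (0 + d)..(1 + d), g x = -r ^ 2 * ∫ x in (0 : ℝ)..1, g x := by
    rw [← intervalIntegral.integral_comp_add_right, ← intervalIntegral.integral_const_mul]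
    congr 1
    ext x
    simp only [hg]
    rw [hd, squareWave_antiperiodic, ← hd, mul_add, Real.exp_add, hr2]
    ring
  have hsh1 : ∫ x in (0 + 1)..(d + 1), g x = Real.exp (-lam) * ∫ x in (0 : ℝ)..d, g x := by
    rw [← intervalIntegral.integral_comp_add_right, ← intervalIntegral.integral_const_mul]
    congr 1
    ext x
    simp only [hg]
    rw [squareWave_periodic N x, mul_add, Real.exp_add, mul_one]
    ring
  have hadd1 := intervalIntegral.integral_add_adjacent_intervals (hgi 0 d) (hgi d (1 + d))
  have hadd2 := intervalIntegral.integral_add_adjacent_intervals (hgi 0 1) (hgi 1 (1 + d))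
  rw [zero_add] at hsh
  rw [zero_add, add_comm d, hV] at hsh1
  rw [hsh, hV] at hadd1
  rw [hsh1] at hadd2
  have hden : 1 + r ^ 2 ≠ 0 := by positivity
  rw [eq_div_iff hden]
  linear_combination hadd2 - hadd1

theorem integral_squareWave_mul_pReal (N : ℕ) {lam : ℝ} (h : 0 < lam) :
    ∫ x in (0 : ℝ)..1, squareWave N x * pReal lam x = errorTerm N lam := by
  have hE : 1 - Real.exp (-lam) ≠ 0 := by
    have : Real.exp (-lam) < 1 := by rw [Real.exp_lt_one_iff]; linarith
    linarith
  have hI := integral_squareWave_mul_exp N h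
  have hI' : ∫ x in (0 : ℝ)..1, squareWave N x * Real.exp (-lam * (1 - x)) =
      ∫ x in (0 : ℝ)..1, squareWave N x * Real.exp (-lam * x) := by
    have := intervalIntegral.integral_comp_sub_left (a := 0) (b := 1)
      (fun x => squareWave N x * Real.exp (-lam * x)) 1
    simp only [squareWave_one_sub, sub_self, sub_zero] at this
    exact this
  have e : ∫ x in (0 : ℝ)..1, squareWave N x * pReal lam x =
      ∫ x in (0 : ℝ)..1, (-(2 / lam) * squareWave N x +
        (1 - Real.exp (-lam))⁻¹ * (squareWave N x * Real.exp (-lam * x) +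
          squareWave N x * Real.exp (-lam * (1 - x)))) := by
    refine intervalIntegral.integral_congr fun x hx => ?_
    rw [Set.uIcc_of_le zero_le_one] at hx
    rw [pReal_eq h hx.1 hx.2]
    ring
  have i0 := intervalIntegrable_squareWave N 0 1
  have i1 := intervalIntegrable_squareWave_mul N
    (g := fun x => Real.exp (-lam * x)) (by fun_prop) 0 1
  have i2 := intervalIntegrable_squareWave_mul N
    (g := fun x => Real.exp (-lam * (1 - x))) (by fun_prop) 0 1
  rw [e, intervalIntegral.integral_add (i0.const_mul _) ((i1.add i2).const_mul _),
    intervalIntegral.integral_const_mul, intervalIntegral.integral_const_mul,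
    intervalIntegral.integral_add i1 i2, integral_squareWave, hI', hI, errorTerm, Real.cosh_eq]
  have hrn : Real.exp (lam / (4 * N + 4)) = (Real.exp (-(lam / (4 * N + 4))))⁻¹ := by
    rw [← Real.exp_neg, neg_neg]
  rw [hrn]
  have hr := Real.exp_pos (-(lam / (4 * N + 4)))
  generalize Real.exp (-(lam / (4 * N + 4))) = r at *
  have hden : 1 + r ^ 2 ≠ 0 := by positivity
  have hden2 : r⁻¹ + r ≠ 0 := by positivity
  field_simp
  ring

theorem continuous_interpPoly (N : ℕ) (lam : ℝ) : Continuous (interpPoly N lam) := by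
  unfold interpPoly
  fun_prop

theorem integral_squareWave_mul_interpPoly (N : ℕ) (lam : ℝ) :
    ∫ x in (0 : ℝ)..1, squareWave N x * interpPoly N lam x = 0 := by
  simp_rw [interpPoly, Finset.mul_sum]
  rw [intervalIntegral.integral_finsetSum fun n _ =>
    intervalIntegrable_squareWave_mul N (by fun_prop) _ _]
  refine Finset.sum_eq_zero fun n hn => ?_
  simp_rw [mul_left_comm _ (interpCoeff N lam n)]
  rw [intervalIntegral.integral_const_mul]
  have h := congrArg Complex.re (integral_squareWave_mul_fourier N hn)
  have hc : Continuous fun x : ℝ => fourier n (x : UnitAddCircle) :=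
    (fourier n).continuous.comp (AddCircle.continuous_mk' 1)
  have h2 := Complex.reCLM.intervalIntegral_comp_comm
    (intervalIntegrable_squareWave_mul_complex N hc 0 1)
  simp only [Complex.reCLM_apply, Complex.re_ofReal_mul, fourier_coe_re] at h2
  rw [h2, h]
  simp

theorem abs_pReal_sub_interpPoly (N : ℕ) {lam : ℝ} (h : 0 < lam) (x : ℝ) :
    |pReal lam x - interpPoly N lam x| =
      squareWave N x * (pReal lam x - interpPoly N lam x) := by
  obtain ⟨R, hR, e⟩ := pReal_sub_interpPoly N h x
  rw [e, ← mul_assoc, squareWave_mul_cos, abs_mul, abs_of_pos hR]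

/-- The `L¹` distance from `p lam` to its interpolating trigonometric polynomial. -/
theorem integral_abs_pReal_sub_interpPoly (N : ℕ) {lam : ℝ} (h : 0 < lam) :
    ∫ x in (0 : ℝ)..1, |pReal lam x - interpPoly N lam x| = errorTerm N lam := by
  simp_rw [abs_pReal_sub_interpPoly N h, mul_sub]
  rw [intervalIntegral.integral_sub, integral_squareWave_mul_pReal N h,
    integral_squareWave_mul_interpPoly, sub_zero]
  · have hE : 1 - Real.exp (-lam) ≠ 0 := by
      have : Real.exp (-lam) < 1 := by rw [Real.exp_lt_one_iff]; linarith
      linarith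
    refine (intervalIntegrable_squareWave_mul N (g := fun x => -(2 / lam) +
      (Real.exp (-lam * x) + Real.exp (-lam * (1 - x))) / (1 - Real.exp (-lam)))
      (by fun_prop) 0 1).congr ?_
    intro x hx
    rw [Set.uIoc_of_le zero_le_one] at hx
    simp only
    rw [pReal_eq h hx.1.le hx.2]
  · exact intervalIntegrable_squareWave_mul N (continuous_interpPoly N lam) _ _

/-! ### Bounds by a multiple of `lam / (lam ^ 2 + 1)` -/

theorem sinh_le_mul_cosh {y : ℝ} (hy : 0 ≤ y) : Real.sinh y ≤ y * Real.cosh y := by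
  have hd : ∀ z : ℝ, HasDerivAt (fun z => z * Real.cosh z - Real.sinh z) (z * Real.sinh z) z := by
    intro z
    have := ((hasDerivAt_id z).fun_mul (Real.hasDerivAt_cosh z)).fun_sub (Real.hasDerivAt_sinh z)
    exact this.congr_deriv (by simp)
  have hm : MonotoneOn (fun z => z * Real.cosh z - Real.sinh z) (Set.Ici 0) := by
    refine monotoneOn_of_deriv_nonneg (convex_Ici 0)
      (fun z _ => (hd z).continuousAt.continuousWithinAt)
      (fun z _ => (hd z).differentiableAt.differentiableWithinAt) fun z hz => ?_
    rw [interior_Ici] at hz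
    rw [(hd z).deriv]
    exact mul_nonneg (Set.mem_Ioi.1 hz).le (Real.sinh_nonneg_iff.2 (Set.mem_Ioi.1 hz).le)
  have := hm (Set.mem_Ici.2 le_rfl) (Set.mem_Ici.2 hy) hy
  simp at this
  linarith

theorem cosh_sub_one_le {y : ℝ} (hy : 0 ≤ y) : Real.cosh y - 1 ≤ y * Real.sinh y := by
  have h1 := sinh_le_mul_cosh (by linarith : 0 ≤ y / 2)
  have h2 := Real.sinh_nonneg_iff.2 (by linarith : 0 ≤ y / 2)
  have e1 := Real.cosh_two_mul (y / 2)
  have e2 := Real.sinh_two_mul (y / 2)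
  have e3 := Real.cosh_sq (y / 2)
  rw [show 2 * (y / 2) = y by ring] at e1 e2
  rw [e1, e2, e3]
  nlinarith

theorem le_sinh {y : ℝ} (hy : 0 ≤ y) : y ≤ Real.sinh y := Real.self_le_sinh_iff.2 hy

/-- The two regimes `lam ≤ 1` and `lam ≥ 1` combined. -/
theorem abs_le_of_two_regimes {lam a C : ℝ} (h : 0 < lam) (h1 : |a| ≤ C * lam)
    (h2 : |a| ≤ C / lam) : |a| ≤ 2 * C * (lam / (lam ^ 2 + 1)) := by
  rw [le_div_iff₀ h] at h2
  rw [← mul_div_assoc, le_div_iff₀ (by positivity)]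
  nlinarith

theorem abs_errorTerm_le (N : ℕ) {lam : ℝ} (h : 0 < lam) :
    |errorTerm N lam| ≤ 4 * (lam / (lam ^ 2 + 1)) := by
  have hM : (1 : ℝ) ≤ 4 * N + 4 := by
    have : (0 : ℝ) ≤ N := by positivity
    linarith
  set y := lam / (4 * N + 4) with hy
  have hy0 : 0 < y := by positivity
  have hyl : y ≤ lam := div_le_self h.le hM
  have hc := Real.one_le_cosh y
  have hc0 := Real.cosh_pos y
  have e : errorTerm N lam = 2 / lam * ((Real.cosh y - 1) / Real.cosh y) := by
    rw [errorTerm, ← hy]; field_simp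
  have h0 : 0 ≤ (Real.cosh y - 1) / Real.cosh y := div_nonneg (by linarith) hc0.le
  have h1 : (Real.cosh y - 1) / Real.cosh y ≤ 1 := by
    rw [div_le_one hc0]; linarith
  have h2 : (Real.cosh y - 1) / Real.cosh y ≤ lam ^ 2 := by
    rw [div_le_iff₀ hc0]
    calc _ ≤ y * Real.sinh y := cosh_sub_one_le hy0.le
      _ ≤ y * (y * Real.cosh y) := by gcongr; exact sinh_le_mul_cosh hy0.le
      _ = y ^ 2 * Real.cosh y := by ring
      _ ≤ _ := by gcongr
  rw [show (4 : ℝ) = 2 * 2 by norm_num]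
  refine abs_le_of_two_regimes h ?_ ?_ <;> rw [e, abs_of_nonneg (by positivity)]
  · calc _ ≤ 2 / lam * lam ^ 2 := by gcongr
      _ = 2 * lam := by field_simp
  · exact mul_le_of_le_one_right (by positivity) h1

theorem abs_inv_sinh_sub_inv_le {y : ℝ} (hy : 0 < y) :
    |1 / Real.sinh y - 1 / y| ≤ y ∧ |1 / Real.sinh y - 1 / y| ≤ 1 / y := by
  have hs := Real.sinh_pos_iff.2 hy
  have h1 := le_sinh hy.le
  have h2 : 1 / Real.sinh y ≤ 1 / y := one_div_le_one_div_of_le hy h1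
  rw [abs_of_nonpos (by linarith)]
  refine ⟨?_, by have : 0 < 1 / Real.sinh y := by positivity
                 linarith⟩
  have h3 := sinh_le_mul_cosh hy.le
  have h4 := mul_le_mul_of_nonneg_left (cosh_sub_one_le hy.le) hy.le
  rw [neg_sub, div_sub_div _ _ hy.ne' hs.ne', div_le_iff₀ (by positivity)]
  linarith

/-- For `n = 0` the term `-2 / lam` cancels the singularity of `hatKernel` as `lam → 0`; for `n ≠ 0`
the denominator of `hatKernel` stays away from `0`. -/
theorem exists_abs_interpCoeff_le (N : ℕ) {n : ℤ} (hn : n ∈ Finset.Icc (-(N : ℤ)) N) :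
    ∃ C : ℝ, ∀ lam : ℝ, 0 < lam → |interpCoeff N lam n| ≤ C * (lam / (lam ^ 2 + 1)) := by
  have hM : (0 : ℝ) < 2 * N + 2 := by positivity
  have hM1 : (2 : ℝ) ≤ 2 * N + 2 := by
    have : (0 : ℝ) ≤ N := by positivity
    linarith
  by_cases h0 : n = 0
  · refine ⟨2 * 2, fun lam h => ?_⟩
    set y := lam / (2 * N + 2) / 2 with hy
    have hy0 : 0 < y := by positivity
    have hs := Real.sinh_pos_iff.2 hy0
    have e : interpCoeff N lam n = 1 / (2 * N + 2) * (1 / Real.sinh y - 1 / y) := by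
      rw [interpCoeff, if_pos h0, hatKernel, h0, ← hy]
      simp only [Int.cast_zero, zero_div, mul_zero, Real.cos_zero, mul_one, Real.sin_zero]
      have : 2 / lam = 1 / (2 * N + 2) * (1 / y) := by rw [hy]; field_simp
      rw [this]
      field_simp
      ring
    obtain ⟨b1, b2⟩ := abs_inv_sinh_sub_inv_le hy0
    refine abs_le_of_two_regimes h ?_ ?_ <;>
      rw [e, abs_mul, abs_of_pos (by positivity : (0 : ℝ) < 1 / (2 * N + 2))]
    · calc _ ≤ 1 * y := by
            gcongr
            rw [div_le_one hM]; linarith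
        _ ≤ 2 * lam := by
            have : y ≤ lam := by
              rw [hy, div_div]; exact div_le_self h.le (by linarith)
            linarith
    · calc _ ≤ 1 / (2 * N + 2) * (1 / y) := by gcongr
        _ = 2 / lam := by rw [hy]; field_simp
  · set s := Real.sin (Real.pi * (n / (2 * N + 2))) ^ 2 with hs
    have hn' : |(n : ℝ)| ≤ N := by
      rw [Finset.mem_Icc, ← abs_le] at hn
      exact_mod_cast hn
    have hs0 : 0 < s := by
      refine sq_pos_of_ne_zero fun hsin => ?_
      rw [Real.sin_eq_zero_iff_of_lt_of_lt] at hsin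
      · rcases mul_eq_zero.1 hsin with hp | hp
        · exact Real.pi_ne_zero hp
        · rw [div_eq_zero_iff] at hp
          rcases hp with hp | hp
          · exact h0 (by exact_mod_cast hp)
          · exact hM.ne' hp
      · have : -1 < (n : ℝ) / (2 * N + 2) := by
          rw [lt_div_iff₀ hM]; linarith [(abs_le.1 hn').1]
        nlinarith [Real.pi_pos]
      · have : (n : ℝ) / (2 * N + 2) < 1 := by
          rw [div_lt_iff₀ hM]; linarith [(abs_le.1 hn').2]
        nlinarith [Real.pi_pos]
    have hs1 : s ≤ 1 := Real.sin_sq_le_one _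
    refine ⟨2 * (2 * (2 * N + 2) / s), fun lam h => ?_⟩
    set y := lam / (2 * N + 2) / 2 with hy
    have hy0 : 0 < y := by positivity
    have hsh := Real.sinh_pos_iff.2 hy0
    have hch := Real.cosh_pos y
    have e : interpCoeff N lam n = 1 / (2 * N + 2) *
        (Real.sinh y * Real.cos (Real.pi * (n / (2 * N + 2))) / (Real.sinh y ^ 2 + s)) := by
      rw [interpCoeff, if_neg h0, hatKernel, ← hy, zero_add]
    have b0 : |interpCoeff N lam n| ≤ Real.sinh y / (Real.sinh y ^ 2 + s) := by
      rw [e, abs_mul, abs_of_pos (by positivity : (0 : ℝ) < 1 / (2 * N + 2)), abs_div, abs_mul,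
        abs_of_pos hsh, abs_of_pos (by positivity : 0 < Real.sinh y ^ 2 + s)]
      calc _ ≤ 1 * (Real.sinh y * 1 / (Real.sinh y ^ 2 + s)) := by
            gcongr
            · rw [div_le_one hM]; linarith
            · exact Real.abs_cos_le_one _
        _ = _ := by ring
    refine abs_le_of_two_regimes h (b0.trans ?_) (b0.trans ?_)
    · have hyl : y ≤ 2 * (2 * N + 2) * lam := by
        have : y ≤ lam := by
          rw [hy, div_div]; exact div_le_self h.le (by linarith)
        nlinarith
      rw [div_le_iff₀ (by positivity), div_mul_eq_mul_div, div_mul_eq_mul_div, le_div_iff₀ hs0]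
      have c1 := Real.cosh_sq y
      have c2 := Real.one_le_cosh y
      calc Real.sinh y * s ≤ y * Real.cosh y * s := by
            gcongr; exact sinh_le_mul_cosh hy0.le
        _ ≤ y * (Real.cosh y * Real.cosh y) * s := by
            gcongr
            exact le_mul_of_one_le_left hch.le c2
        _ = y * (Real.sinh y ^ 2 * s + s) := by rw [← pow_two, c1]; ring
        _ ≤ y * (Real.sinh y ^ 2 * 1 + s) := by gcongr
        _ ≤ 2 * (2 * N + 2) * lam * (Real.sinh y ^ 2 + s) := by rw [mul_one]; gcongr
    · calc Real.sinh y / (Real.sinh y ^ 2 + s) ≤ Real.sinh y / (Real.sinh y ^ 2) := by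
            gcongr; linarith
        _ = 1 / Real.sinh y := by field_simp
        _ ≤ 1 / y := one_div_le_one_div_of_le hy0 (le_sinh hy0.le)
        _ = 2 * (2 * N + 2) / 1 / lam := by rw [hy]; field_simp
        _ ≤ _ := by gcongr

theorem abs_pReal_le {lam δ x : ℝ} (h : 0 < lam) (hδ : 0 < δ) (h0 : δ ≤ x) (h1 : x ≤ 1 - δ) :
    |pReal lam x| ≤ 4 / δ * (lam / (lam ^ 2 + 1)) := by
  have hδ1 : δ ≤ 1 := by linarith
  have hE : 0 < 1 - Real.exp (-lam) := by
    have : Real.exp (-lam) < 1 := by rw [Real.exp_lt_one_iff]; linarith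
    linarith
  set P := (Real.exp (-lam * x) + Real.exp (-lam * (1 - x))) / (1 - Real.exp (-lam)) with hP
  have e : pReal lam x = P - 2 / lam := by
    rw [pReal_eq h (hδ.le.trans h0) (by linarith)]; ring
  have hP0 : 0 < P := by positivity
  -- for small `lam` compare with the hyperbolic functions of `u = lam / 2`
  set u := lam / 2 with hu
  have hu0 : 0 < u := half_pos h
  have hsh := Real.sinh_pos_iff.2 hu0
  have hPc : P = Real.cosh (lam * (x - 1 / 2)) / Real.sinh u := by
    have a1 : Real.exp (-lam * x) = Real.exp (-u) * Real.exp (-(lam * (x - 1 / 2))) := by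
      rw [← Real.exp_add, hu]; ring_nf
    have a2 : Real.exp (-lam * (1 - x)) = Real.exp (-u) * Real.exp (lam * (x - 1 / 2)) := by
      rw [← Real.exp_add, hu]; ring_nf
    have a3 : 1 - Real.exp (-lam) = Real.exp (-u) * (2 * Real.sinh u) := by
      rw [Real.sinh_eq, mul_div_cancel₀ _ two_ne_zero, mul_sub, ← Real.exp_add, ← Real.exp_add,
        neg_add_cancel, Real.exp_zero, hu]
      ring_nf
    rw [hP, a1, a2, a3, Real.cosh_eq, ← mul_add, mul_div_mul_left _ _ (Real.exp_pos _).ne']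
    field_simp
    ring
  have hlow : 1 / Real.sinh u ≤ P := by
    rw [hPc]; gcongr; exact Real.one_le_cosh _
  have hup : P ≤ 1 / u + u := by
    rw [hPc, div_le_iff₀ hsh]
    have c1 : Real.cosh (lam * (x - 1 / 2)) ≤ Real.cosh u := by
      rw [Real.cosh_le_cosh, abs_mul, abs_of_pos h, abs_of_pos hu0, hu]
      have : |x - 1 / 2| ≤ 1 / 2 := abs_le.2 ⟨by linarith, by linarith⟩
      nlinarith
    have c2 := cosh_sub_one_le hu0.le
    have c3 := le_sinh hu0.le
    have c4 : 1 ≤ 1 / u * Real.sinh u := by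
      rw [one_div, ← div_eq_inv_mul, one_le_div hu0]; exact c3
    calc _ ≤ 1 + u * Real.sinh u := by linarith
      _ ≤ _ := by linarith
  have hinv : 2 / lam = 1 / u := by rw [hu]; field_simp
  have hC : 1 ≤ 2 / δ := by rw [le_div_iff₀ hδ]; linarith
  rw [show 4 / δ = 2 * (2 / δ) by ring]
  refine abs_le_of_two_regimes h ?_ ?_
  · have hb := (abs_le.1 (abs_inv_sinh_sub_inv_le hu0).1).1
    have : |pReal lam x| ≤ u := by
      rw [e, hinv, abs_le]
      constructor <;> linarith
    nlinarith
  · have hexp : ∀ z : ℝ, 0 ≤ z → Real.exp (-z) ≤ 1 / (1 + z) := by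
      intro z hz
      rw [Real.exp_neg, inv_eq_one_div]
      exact one_div_le_one_div_of_le (by linarith) (by linarith [Real.add_one_le_exp z])
    have b1 : Real.exp (-lam * x) ≤ 1 / (1 + lam * δ) := by
      refine le_trans ?_ (hexp (lam * δ) (by positivity))
      rw [Real.exp_le_exp]; nlinarith
    have b2 : Real.exp (-lam * (1 - x)) ≤ 1 / (1 + lam * δ) := by
      refine le_trans ?_ (hexp (lam * δ) (by positivity))
      rw [Real.exp_le_exp]; nlinarith
    have b3 : lam / (1 + lam) ≤ 1 - Real.exp (-lam) := by
      have := hexp lam h.le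
      have e2 : lam / (1 + lam) = 1 - 1 / (1 + lam) := by field_simp; ring
      linarith
    have hPb : P ≤ 2 / δ / lam := by
      calc P ≤ (1 / (1 + lam * δ) + 1 / (1 + lam * δ)) / (lam / (1 + lam)) := by
            rw [hP]; gcongr
        _ = 2 * (1 + lam) / ((1 + lam * δ) * lam) := by field_simp; norm_num
        _ ≤ 2 / δ / lam := by
            rw [div_div, div_le_div_iff₀ (by positivity) (by positivity)]
            nlinarith
    have hCl : 2 / lam ≤ 2 / δ / lam := by gcongr; rw [le_div_iff₀ hδ]; linarith
    have : 0 < 2 / lam := by positivity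
    rw [e, abs_le]
    constructor <;> linarith

/-! ### Uniqueness of trigonometric interpolation -/

theorem isTrigPoly_continuous {N : ℕ} {f : UnitAddCircle → ℂ} (hf : IsTrigPoly N f) :
    Continuous f := by
  obtain ⟨c, hc⟩ := hf
  rw [funext hc]
  exact continuous_finsetSum _ fun n _ => continuous_const.mul (fourier n).continuous

/-- The zeros of `cos (π (2N + 2) x)` in `(0, 1)`. -/
def node (N : ℕ) (j : ℕ) : ℝ := (j + 1 / 2) / (2 * N + 2)

theorem node_mem (N : ℕ) {j : ℕ} (hj : j < 2 * N + 2) : node N j ∈ Set.Ioo (0 : ℝ) 1 := by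
  have hM : (0 : ℝ) < 2 * N + 2 := by positivity
  have hj' : (j : ℝ) + 1 ≤ 2 * N + 2 := by exact_mod_cast hj
  refine ⟨by unfold node; positivity, ?_⟩
  rw [node, div_lt_one hM]
  linarith

/-- A trigonometric polynomial of degree at most `N` is determined by its values at the `2N + 2`
nodes. -/
theorem isTrigPoly_eq_of_node {N : ℕ} {f g : UnitAddCircle → ℂ} (hf : IsTrigPoly N f)
    (hg : IsTrigPoly N g) (h : ∀ j < 2 * N + 2, f (node N j) = g (node N j)) : f = g := by
  obtain ⟨c, hc⟩ := hf
  obtain ⟨d, hd⟩ := hg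
  have hsum : ∀ (e : ℤ → ℂ) (x : UnitAddCircle),
      ∑ n ∈ Finset.Icc (-(N : ℤ)) N, e n * fourier n x =
      ∑ i ∈ Finset.range (2 * N + 1), e (i - N) * fourier ((i : ℤ) - N) x := by
    intro e x
    symm
    refine Finset.sum_nbij' (fun i => (i : ℤ) - N) (fun n => (n + N).toNat) ?_ ?_ ?_ ?_ ?_
    · intro i hi; rw [Finset.mem_range] at hi; rw [Finset.mem_Icc]; omega
    · intro n hn; rw [Finset.mem_Icc] at hn; rw [Finset.mem_range]; omega
    · intro i _; simp
    · intro n hn; rw [Finset.mem_Icc] at hn; omega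
    · intro i _; rfl
  set P : Polynomial ℂ := ∑ i ∈ Finset.range (2 * N + 1),
    Polynomial.C (c (i - N) - d (i - N)) * Polynomial.X ^ i with hP
  have heval : ∀ x : UnitAddCircle, P.eval (fourier 1 x) = fourier (N : ℤ) x * (f x - g x) := by
    intro x
    rw [hc, hd, hsum, hsum, ← Finset.sum_sub_distrib, Finset.mul_sum, hP,
      Polynomial.eval_finsetSum]
    refine Finset.sum_congr rfl fun i _ => ?_
    have hpow : (fourier 1 x : ℂ) ^ i = fourier (N : ℤ) x * fourier ((i : ℤ) - N) x := by
      rw [← fourier_add, add_sub_cancel]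
      simp [fourier_apply, AddCircle.toCircle_nsmul]
    rw [Polynomial.eval_mul, Polynomial.eval_C, Polynomial.eval_pow, Polynomial.eval_X, hpow]
    ring
  have hdeg : P.natDegree ≤ 2 * N := by
    refine Polynomial.natDegree_sum_le_of_forall_le _ _ fun i hi => ?_
    rw [Finset.mem_range] at hi
    exact (Polynomial.natDegree_C_mul_X_pow_le _ _).trans (by omega)
  have hinj : Function.Injective fun j : Fin (2 * N + 2) =>
      (fourier 1 ((node N j : ℝ) : UnitAddCircle) : ℂ) := by
    intro i j hij
    simp only [fourier_one] at hij
    have h1 := AddCircle.injective_toCircle one_ne_zero (Subtype.ext hij)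
    have hi := node_mem N i.2
    have hj := node_mem N j.2
    rw [AddCircle.coe_eq_coe_iff_of_mem_Ico (a := 0) ⟨hi.1.le, by linarith [hi.2]⟩
      ⟨hj.1.le, by linarith [hj.2]⟩] at h1
    have hM : (2 * N + 2 : ℝ) ≠ 0 := by positivity
    rw [node, node, div_left_inj' hM] at h1
    have : (i : ℝ) = (j : ℝ) := by linarith
    exact Fin.ext (by exact_mod_cast this)
  have hP0 : P = 0 := by
    refine Polynomial.eq_zero_of_natDegree_lt_card_of_eval_eq_zero P hinj (fun j => ?_) ?_
    · rw [heval, h j j.2, sub_self, mul_zero]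
    · rw [Fintype.card_fin]; omega
  ext x
  have := heval x
  rw [hP0, Polynomial.eval_zero] at this
  have hne : (fourier (N : ℤ) x : ℂ) ≠ 0 := by
    rw [fourier_apply]; exact Circle.coe_ne_zero _
  exact sub_eq_zero.1 ((mul_eq_zero.1 this.symm).resolve_left hne)

theorem squareWave_left_of_node (N j : ℕ) {x : ℝ}
    (hx : x ∈ Set.Ioo (j / (2 * N + 2) : ℝ) (node N j)) : squareWave N x = (-1) ^ j := by
  have hM : (0 : ℝ) < 2 * N + 2 := by positivity
  have h1 := (div_lt_iff₀ hM).1 hx.1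
  have h2 := (lt_div_iff₀ hM).1 hx.2
  have hc : 0 < Real.cos (Real.pi * (2 * N + 2) * x - j * Real.pi) := by
    refine Real.cos_pos_of_mem_Ioo ⟨?_, ?_⟩ <;> nlinarith [Real.pi_pos]
  rw [Real.cos_sub_nat_mul_pi] at hc
  rcases neg_one_pow_eq_or ℝ j with hj | hj <;> rw [hj] at hc ⊢
  · exact squareWave_of_pos (by linarith)
  · exact squareWave_of_neg (by linarith)

theorem squareWave_right_of_node (N j : ℕ) {x : ℝ}
    (hx : x ∈ Set.Ioo (node N j) ((j + 1) / (2 * N + 2) : ℝ)) : squareWave N x = -(-1) ^ j := by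
  have hM : (0 : ℝ) < 2 * N + 2 := by positivity
  have h1 := (div_lt_iff₀ hM).1 hx.1
  have h2 := (lt_div_iff₀ hM).1 hx.2
  have hc : Real.cos (Real.pi * (2 * N + 2) * x - j * Real.pi) < 0 := by
    refine Real.cos_neg_of_pi_div_two_lt_of_lt ?_ ?_ <;> nlinarith [Real.pi_pos]
  rw [Real.cos_sub_nat_mul_pi] at hc
  rcases neg_one_pow_eq_or ℝ j with hj | hj <;> rw [hj] at hc ⊢
  · exact squareWave_of_neg (by linarith)
  · rw [neg_neg]; exact squareWave_of_pos (by linarith)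

/-- A function vanishing almost everywhere on an interval vanishes at every point of its closure
where it is continuous. -/
theorem eq_zero_of_ae_Ioo {g : ℝ → ℝ} {a b c : ℝ} (hab : a < b) (hc : c ∈ Set.Icc a b)
    (hg : ContinuousAt g c) (h : ∀ᵐ x, x ∈ Set.Ioo a b → g x = 0) : g c = 0 := by
  by_contra hne
  obtain ⟨U, hU, hUo, hcU⟩ := eventually_nhds_iff.1 (hg.eventually_ne hne)
  rw [← closure_Ioo hab.ne] at hc
  have hpos : 0 < volume (U ∩ Set.Ioo a b) :=
    (hUo.inter isOpen_Ioo).measure_pos volume (mem_closure_iff.1 hc U hUo hcU)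
  refine hpos.ne' (measure_mono_null ?_ h)
  intro x hx hx'
  exact hU x hx.1 (hx' hx.2)

/-! ### Integration against `μ` -/

section Measure

variable {μ : Measure (Set.Ioi (0 : ℝ))}

/-- The integrability of `lam / (lam ^ 2 + 1)` against `μ`, in terms of the Bochner integral. -/
abbrev WeightIntegrable (μ : Measure (Set.Ioi (0 : ℝ))) : Prop :=
  Integrable (fun lam : Set.Ioi (0 : ℝ) => (lam : ℝ) / ((lam : ℝ) ^ 2 + 1)) μ

theorem integrable_weight
    (hμ : ∫⁻ lam : Set.Ioi (0 : ℝ), ENNReal.ofReal ((lam : ℝ) / ((lam : ℝ) ^ 2 + 1)) ∂μ < ⊤) :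
    WeightIntegrable μ := by
  refine (lintegral_ofReal_ne_top_iff_integrable ?_ (Filter.Eventually.of_forall fun lam => ?_)).1
    hμ.ne
  · exact Measurable.aestronglyMeasurable (by fun_prop)
  · have : (0 : ℝ) < lam := lam.2
    positivity

/-- The weight is positive and integrable, so `μ` is `σ`-finite and Fubini's theorem applies. -/
theorem sigmaFinite_of_integrable_weight
    (hw : WeightIntegrable μ) : SigmaFinite μ := by
  obtain ⟨t, ht, h0, hs⟩ := hw.aefinStronglyMeasurable.exists_set_sigmaFinite
  have hmem : ∀ᵐ lam ∂μ, lam ∈ t := by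
    filter_upwards [(ae_restrict_iff' ht.compl).1 h0] with lam hlam
    by_contra hn
    have h1 := hlam hn
    have : (0 : ℝ) < lam := lam.2
    have : (0 : ℝ) < (lam : ℝ) / ((lam : ℝ) ^ 2 + 1) := by positivity
    exact this.ne' h1
  rwa [Measure.restrict_eq_self_of_ae_mem hmem] at hs

theorem integrable_of_abs_le
    (hw : WeightIntegrable μ)
    {g : ℝ → ℝ} (hg : Measurable g) {C : ℝ}
    (hC : ∀ lam, 0 < lam → |g lam| ≤ C * (lam / (lam ^ 2 + 1))) :
    Integrable (fun lam : Set.Ioi (0 : ℝ) => g lam) μ :=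
  (hw.const_mul C).mono' (hg.comp measurable_subtype_coe).aestronglyMeasurable
    (Filter.Eventually.of_forall fun lam => hC lam lam.2)

theorem measurable_interpCoeff (N : ℕ) (n : ℤ) : Measurable fun lam => interpCoeff N lam n := by
  unfold interpCoeff hatKernel
  split_ifs <;> fun_prop

theorem measurable_interpPoly (N : ℕ) :
    Measurable fun z : ℝ × ℝ => interpPoly N z.1 z.2 := by
  unfold interpPoly
  refine Finset.measurable_sum _ fun n _ => ?_
  exact ((measurable_interpCoeff N n).comp measurable_fst).mul (by fun_prop)

theorem measurable_errorTerm (N : ℕ) : Measurable (errorTerm N) := by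
  unfold errorTerm
  fun_prop

/-- The closed form of `pReal` on `[0, 1]`, as a measurable function of both variables. -/
def pClosed (lam x : ℝ) : ℝ :=
  -(2 / lam) + (Real.exp (-lam * x) + Real.exp (-lam * (1 - x))) / (1 - Real.exp (-lam))

theorem measurable_pClosed : Measurable fun z : ℝ × ℝ => pClosed z.1 z.2 := by
  unfold pClosed
  fun_prop

theorem continuous_pClosed (lam : ℝ) : Continuous (pClosed lam) := by
  unfold pClosed
  fun_prop

theorem pReal_eq_pClosed {lam : ℝ} (h : 0 < lam) {x : ℝ} (hx : x ∈ Set.Icc (0 : ℝ) 1) :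
    pReal lam x = pClosed lam x := pReal_eq h hx.1 hx.2

theorem pReal_fract (lam x : ℝ) : pReal lam (Int.fract x) = pReal lam x := by
  have := (pReal_periodic lam).sub_zsmul_eq (x := x) ⌊x⌋
  rwa [zsmul_one] at this

theorem aestronglyMeasurable_pReal (x : ℝ) :
    AEStronglyMeasurable (fun lam : Set.Ioi (0 : ℝ) => pReal lam x) μ := by
  have e : (fun lam : Set.Ioi (0 : ℝ) => pReal lam x) =
      fun lam : Set.Ioi (0 : ℝ) => pClosed lam (Int.fract x) := by
    ext lam
    rw [← pReal_fract, pReal_eq_pClosed lam.2 ⟨Int.fract_nonneg x, (Int.fract_lt_one x).le⟩]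
  rw [e]
  have : Measurable fun lam : ℝ => pClosed lam (Int.fract x) :=
    measurable_pClosed.comp (measurable_id.prodMk measurable_const)
  exact (this.comp measurable_subtype_coe).aestronglyMeasurable

theorem integrable_pReal
    (hw : WeightIntegrable μ)
    {x : ℝ} (hx : Int.fract x ≠ 0) :
    Integrable (fun lam : Set.Ioi (0 : ℝ) => pReal lam x) μ := by
  have h0 : 0 < Int.fract x := lt_of_le_of_ne (Int.fract_nonneg x) hx.symm
  have h1 := Int.fract_lt_one x
  set δ := min (Int.fract x) (1 - Int.fract x) with hδ
  have hδ0 : 0 < δ := lt_min h0 (by linarith)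
  refine (hw.const_mul (4 / δ)).mono' (aestronglyMeasurable_pReal x)
    (Filter.Eventually.of_forall fun lam => ?_)
  rw [Real.norm_eq_abs, ← pReal_fract]
  exact abs_pReal_le lam.2 hδ0 (min_le_left _ _)
    (by have := min_le_right (Int.fract x) (1 - Int.fract x); linarith)

theorem integrable_errorTerm
    (hw : WeightIntegrable μ) (N : ℕ) :
    Integrable (fun lam : Set.Ioi (0 : ℝ) => errorTerm N lam) μ :=
  integrable_of_abs_le hw (measurable_errorTerm N) fun _ h => abs_errorTerm_le N h

theorem integrable_interpCoeff
    (hw : WeightIntegrable μ) (N : ℕ)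
    {n : ℤ} (hn : n ∈ Finset.Icc (-(N : ℤ)) N) :
    Integrable (fun lam : Set.Ioi (0 : ℝ) => interpCoeff N lam n) μ := by
  obtain ⟨C, hC⟩ := exists_abs_interpCoeff_le N hn
  exact integrable_of_abs_le hw (measurable_interpCoeff N n) hC

theorem integrable_interpPoly
    (hw : WeightIntegrable μ) (N : ℕ)
    (x : ℝ) : Integrable (fun lam : Set.Ioi (0 : ℝ) => interpPoly N lam x) μ :=
  integrable_finsetSum _ fun _ hn => (integrable_interpCoeff hw N hn).mul_const _

theorem kCoeff_eq {N : ℕ} {n : ℤ} (hn : n ∈ Finset.Icc (-(N : ℤ)) N) :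
    kCoeff μ N n = ((∫ lam : Set.Ioi (0 : ℝ), interpCoeff N lam n ∂μ : ℝ) : ℂ) := by
  have hM : (0 : ℝ) < 2 * N + 2 := by positivity
  have hh : ∀ lam : Set.Ioi (0 : ℝ), expInterpHat ((lam : ℝ) / (2 * N + 2)) ((n : ℝ) / (2 * N + 2))
      = (hatKernel ((lam : ℝ) / (2 * N + 2)) ((n : ℝ) / (2 * N + 2)) : ℂ) :=
    fun lam => expInterpHat_div_eq N (div_pos lam.2 hM) hn
  rw [kCoeff, ← integral_complex_ofReal]
  split_ifs with h0
  · subst h0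
    refine integral_congr_ae (Filter.Eventually.of_forall fun lam => ?_)
    have := hh lam
    rw [Int.cast_zero, zero_div] at this
    simp only [interpCoeff, this]
    push_cast
    simp
  · rw [← integral_const_mul]
    refine integral_congr_ae (Filter.Eventually.of_forall fun lam => ?_)
    simp only [hh, interpCoeff, if_neg h0]
    push_cast
    simp

theorem k_im (N : ℕ) (x : ℝ) : (k μ N (x : UnitAddCircle)).im = 0 := by
  rw [k, Complex.im_sum]
  have e : ∀ n ∈ Finset.Icc (-(N : ℤ)) N, (kCoeff μ N n * fourier n (x : UnitAddCircle)).im =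
      (∫ lam : Set.Ioi (0 : ℝ), interpCoeff N lam n ∂μ) * Real.sin (2 * Real.pi * n * x) := by
    intro n hn
    rw [kCoeff_eq hn, Complex.im_ofReal_mul, fourier_coe_im]
  rw [Finset.sum_congr rfl e]
  -- the summand is odd in `n`
  have hodd : ∑ n ∈ Finset.Icc (-(N : ℤ)) N,
      (∫ lam : Set.Ioi (0 : ℝ), interpCoeff N lam n ∂μ) * Real.sin (2 * Real.pi * n * x) =
      ∑ n ∈ Finset.Icc (-(N : ℤ)) N,
      -((∫ lam : Set.Ioi (0 : ℝ), interpCoeff N lam n ∂μ) * Real.sin (2 * Real.pi * n * x)) := by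
    refine Finset.sum_nbij' (fun n => -n) (fun n => -n) ?_ ?_ ?_ ?_ ?_
    · intro n hn; rw [Finset.mem_Icc] at hn ⊢; omega
    · intro n hn; rw [Finset.mem_Icc] at hn ⊢; omega
    · intro n _; simp
    · intro n _; simp
    · intro n _
      simp only [interpCoeff_neg, Int.cast_neg]
      rw [show 2 * Real.pi * -(n : ℝ) * x = -(2 * Real.pi * n * x) by ring, Real.sin_neg]
      ring
  rw [Finset.sum_neg_distrib] at hodd
  linarith

theorem k_re
    (hw : WeightIntegrable μ) (N : ℕ)
    (x : ℝ) : (k μ N (x : UnitAddCircle)).re =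
      ∫ lam : Set.Ioi (0 : ℝ), interpPoly N lam x ∂μ := by
  simp_rw [interpPoly]
  rw [integral_finsetSum _ fun n hn => (integrable_interpCoeff hw N hn).mul_const _, k,
    Complex.re_sum]
  refine Finset.sum_congr rfl fun n hn => ?_
  rw [kCoeff_eq hn, Complex.re_ofReal_mul, fourier_coe_re, integral_mul_const]

theorem isTrigPoly_k (N : ℕ) : IsTrigPoly N (k μ N) := ⟨kCoeff μ N, fun _ => rfl⟩

theorem q_eq {x : ℝ} (hx : Integrable (fun lam : Set.Ioi (0 : ℝ) => pReal lam x) μ) :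
    q μ (x : UnitAddCircle) = ((∫ lam : Set.Ioi (0 : ℝ), pReal lam x ∂μ : ℝ) : EReal) := by
  have h1 : ∫⁻ lam : Set.Ioi (0 : ℝ), ENNReal.ofReal (pReal lam x) ∂μ ≠ ⊤ :=
    ((lintegral_mono fun _ => Real.ofReal_le_enorm _).trans_lt hx.2).ne
  have h2 : ∫⁻ lam : Set.Ioi (0 : ℝ), ENNReal.ofReal (-pReal lam x) ∂μ ≠ ⊤ :=
    ((lintegral_mono fun _ => Real.ofReal_le_enorm _).trans_lt hx.neg.2).ne
  rw [integral_eq_lintegral_pos_part_sub_lintegral_neg_part hx, EReal.coe_sub,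
    EReal.coe_ennreal_toReal h1, EReal.coe_ennreal_toReal h2]
  rfl

end Measure

/-! ### The error of the averaged interpolation -/

section Measure

variable {μ : Measure (Set.Ioi (0 : ℝ))}

theorem abs_pClosed_sub_interpPoly (N : ℕ) {lam : ℝ} (h : 0 < lam) {x : ℝ}
    (hx : x ∈ Set.Icc (0 : ℝ) 1) :
    |pClosed lam x - interpPoly N lam x| =
      squareWave N x * (pClosed lam x - interpPoly N lam x) := by
  rw [← pReal_eq_pClosed h hx, abs_pReal_sub_interpPoly N h]

theorem setIntegral_abs_pClosed_sub_interpPoly (N : ℕ) {lam : ℝ} (h : 0 < lam) :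
    ∫ x in Set.Ioc (0 : ℝ) 1, |pClosed lam x - interpPoly N lam x| = errorTerm N lam := by
  rw [← integral_abs_pReal_sub_interpPoly N h, intervalIntegral.integral_of_le zero_le_one]
  refine setIntegral_congr_fun measurableSet_Ioc fun x hx => ?_
  rw [pReal_eq_pClosed h ⟨hx.1.le, hx.2⟩]

theorem integrable_prod_pClosed_sub_interpPoly
    (hw : WeightIntegrable μ) (N : ℕ) :
    Integrable (fun z : Set.Ioi (0 : ℝ) × ℝ => pClosed z.1 z.2 - interpPoly N z.1 z.2)
      (μ.prod (volume.restrict (Set.Ioc (0 : ℝ) 1))) := by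
  have hm : Measurable fun z : ℝ × ℝ => pClosed z.1 z.2 - interpPoly N z.1 z.2 :=
    measurable_pClosed.sub (measurable_interpPoly N)
  have hm' : Measurable fun z : Set.Ioi (0 : ℝ) × ℝ => pClosed z.1 z.2 - interpPoly N z.1 z.2 :=
    hm.comp ((measurable_subtype_coe.comp measurable_fst).prodMk measurable_snd)
  refine (integrable_prod_iff hm'.aestronglyMeasurable).2
    ⟨Filter.Eventually.of_forall fun lam => ?_, ?_⟩
  · exact ((continuous_pClosed lam).sub (continuous_interpPoly N lam)).integrableOn_Ioc
  · refine (integrable_errorTerm hw N).congr (Filter.Eventually.of_forall fun lam => ?_)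
    exact (setIntegral_abs_pClosed_sub_interpPoly N lam.2).symm

theorem fract_ne_zero_of_mem {x : ℝ} (hx : x ∈ Set.Ioo (0 : ℝ) 1) : Int.fract x ≠ 0 := by
  rw [Int.fract_eq_self.2 ⟨hx.1.le, hx.2⟩]
  exact hx.1.ne'

theorem q_toReal_eq
    (hw : WeightIntegrable μ) {x : ℝ}
    (hx : x ∈ Set.Ioo (0 : ℝ) 1) :
    (q μ (x : UnitAddCircle)).toReal = ∫ lam : Set.Ioi (0 : ℝ), pClosed lam x ∂μ := by
  rw [q_eq (integrable_pReal hw (fract_ne_zero_of_mem hx)), EReal.toReal_coe]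
  exact integral_congr_ae (Filter.Eventually.of_forall fun lam =>
    pReal_eq_pClosed lam.2 ⟨hx.1.le, hx.2.le⟩)

theorem integrable_pClosed
    (hw : WeightIntegrable μ) {x : ℝ}
    (hx : x ∈ Set.Ioo (0 : ℝ) 1) :
    Integrable (fun lam : Set.Ioi (0 : ℝ) => pClosed lam x) μ :=
  (integrable_pReal hw (fract_ne_zero_of_mem hx)).congr (Filter.Eventually.of_forall fun lam =>
    pReal_eq_pClosed lam.2 ⟨hx.1.le, hx.2.le⟩)

theorem q_toReal_sub_k_re
    (hw : WeightIntegrable μ) (N : ℕ)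
    {x : ℝ} (hx : x ∈ Set.Ioo (0 : ℝ) 1) :
    (q μ (x : UnitAddCircle)).toReal - (k μ N (x : UnitAddCircle)).re =
      ∫ lam : Set.Ioi (0 : ℝ), (pClosed lam x - interpPoly N lam x) ∂μ := by
  rw [q_toReal_eq hw hx, k_re hw,
    integral_sub (integrable_pClosed hw hx) (integrable_interpPoly hw N x)]

theorem squareWave_mul_q_sub_k
    (hw : WeightIntegrable μ) (N : ℕ)
    {x : ℝ} (hx : x ∈ Set.Ioo (0 : ℝ) 1) :
    squareWave N x * ((q μ (x : UnitAddCircle)).toReal - (k μ N (x : UnitAddCircle)).re) =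
      ∫ lam : Set.Ioi (0 : ℝ), |pClosed lam x - interpPoly N lam x| ∂μ := by
  rw [q_toReal_sub_k_re hw N hx, ← integral_const_mul]
  exact integral_congr_ae (Filter.Eventually.of_forall fun lam =>
    (abs_pClosed_sub_interpPoly N lam.2 ⟨hx.1.le, hx.2.le⟩).symm)

theorem ae_mem_Ioo : ∀ᵐ x ∂(volume.restrict (Set.Ioc (0 : ℝ) 1)), x ∈ Set.Ioo (0 : ℝ) 1 := by
  rw [← restrict_Ioo_eq_restrict_Ioc]
  exact ae_restrict_mem measurableSet_Ioo

theorem continuous_coe_trigPoly {N : ℕ} {f : UnitAddCircle → ℂ} (hf : IsTrigPoly N f) :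
    Continuous fun x : ℝ => f (x : UnitAddCircle) :=
  (isTrigPoly_continuous hf).comp (AddCircle.continuous_mk' 1)

/-- Off the integers `q` is the sum of a trigonometric polynomial and the `μ`-integral of the
interpolation errors, which are integrable jointly in `(lam, x)`. -/
theorem integrableOn_q
    (hw : WeightIntegrable μ) :
    IntegrableOn (fun x : ℝ => (q μ (x : UnitAddCircle)).toReal) (Set.Ioc 0 1) := by
  have := sigmaFinite_of_integrable_weight hw
  have h1 := (integrable_prod_pClosed_sub_interpPoly hw 0).integral_prod_right
  have h2 : IntegrableOn (fun x : ℝ => (k μ 0 (x : UnitAddCircle)).re) (Set.Ioc 0 1) :=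
    (Complex.continuous_re.comp (continuous_coe_trigPoly (isTrigPoly_k 0))).integrableOn_Ioc
  refine (h1.add h2).congr ?_
  filter_upwards [ae_mem_Ioo] with x hx
  rw [Pi.add_apply, ← q_toReal_sub_k_re hw 0 hx, sub_add_cancel]

theorem integrable_q
    (hw : WeightIntegrable μ) :
    Integrable (fun x : UnitAddCircle => (q μ x).toReal) := by
  have h := (integrableOn_iff_comap_subtypeVal measurableSet_Ioc).1 (integrableOn_q hw)
  have he : Set.Ioc (0 : ℝ) 1 = Set.Ioc 0 (0 + 1) := by rw [zero_add]
  rw [he] at h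
  have h2 := ((AddCircle.measurePreserving_equivIoc 1 (a := 0)).integrable_comp_emb
    (AddCircle.measurableEquivIoc 1 0).measurableEmbedding).2 h
  refine h2.congr (Filter.Eventually.of_forall fun x => ?_)
  simp only [Function.comp_apply]
  rw [AddCircle.coe_equivIoc]

theorem integral_squareWave_mul_q_sub_k
    (hw : WeightIntegrable μ) (N : ℕ) :
    ∫ x in Set.Ioc (0 : ℝ) 1, squareWave N x *
      ((q μ (x : UnitAddCircle)).toReal - (k μ N (x : UnitAddCircle)).re) =
      ∫ lam : Set.Ioi (0 : ℝ), errorTerm N lam ∂μ := by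
  have := sigmaFinite_of_integrable_weight hw
  have hsw := integral_integral_swap
    (f := fun (lam : Set.Ioi (0 : ℝ)) (x : ℝ) => |pClosed lam x - interpPoly N lam x|)
    (integrable_prod_pClosed_sub_interpPoly hw N).abs
  have e1 : ∫ x in Set.Ioc (0 : ℝ) 1, squareWave N x *
      ((q μ (x : UnitAddCircle)).toReal - (k μ N (x : UnitAddCircle)).re) =
      ∫ x in Set.Ioc (0 : ℝ) 1,
        ∫ lam : Set.Ioi (0 : ℝ), |pClosed lam x - interpPoly N lam x| ∂μ := by
    refine integral_congr_ae ?_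
    filter_upwards [ae_mem_Ioo] with x hx
    exact squareWave_mul_q_sub_k hw N hx
  rw [e1, ← hsw]
  exact integral_congr_ae (Filter.Eventually.of_forall fun lam =>
    setIntegral_abs_pClosed_sub_interpPoly N lam.2)

theorem integrableOn_q_sub
    (hw : WeightIntegrable μ) {N : ℕ}
    {f : UnitAddCircle → ℂ} (hf : IsTrigPoly N f) :
    IntegrableOn (fun x : ℝ => (((q μ (x : UnitAddCircle)).toReal : ℝ) : ℂ) -
      f (x : UnitAddCircle)) (Set.Ioc 0 1) :=
  (integrableOn_q hw).ofReal.sub (continuous_coe_trigPoly hf).integrableOn_Ioc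

theorem integrableOn_squareWave_mul {N : ℕ} {g : ℝ → ℂ} (hg : IntegrableOn g (Set.Ioc 0 1)) :
    IntegrableOn (fun x => (squareWave N x : ℂ) * g x) (Set.Ioc 0 1) := by
  refine Integrable.bdd_mul (c := 1) hg
    (Complex.measurable_ofReal.comp (measurable_squareWave N)).aestronglyMeasurable
    (Filter.Eventually.of_forall fun x => ?_)
  rw [Complex.norm_real]
  exact abs_squareWave_le_one N x

/-- Since trigonometric polynomials of degree at most `N` are orthogonal to the square wave, the
integral of `(q - f)` against it does not depend on `f`. -/
theorem integral_squareWave_mul_q_sub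
    (hw : WeightIntegrable μ) {N : ℕ}
    {f : UnitAddCircle → ℂ} (hf : IsTrigPoly N f) :
    ∫ x in Set.Ioc (0 : ℝ) 1, (squareWave N x : ℂ) *
      ((((q μ (x : UnitAddCircle)).toReal : ℝ) : ℂ) - f (x : UnitAddCircle)) =
      ((∫ lam : Set.Ioi (0 : ℝ), errorTerm N lam ∂μ : ℝ) : ℂ) := by
  have h0 : ∀ {g : UnitAddCircle → ℂ}, IsTrigPoly N g →
      ∫ x in Set.Ioc (0 : ℝ) 1, (squareWave N x : ℂ) *
      ((((q μ (x : UnitAddCircle)).toReal : ℝ) : ℂ) - g (x : UnitAddCircle)) =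
      ∫ x in Set.Ioc (0 : ℝ) 1, (squareWave N x : ℂ) *
      (((q μ (x : UnitAddCircle)).toReal : ℝ) : ℂ) := by
    intro g hg
    have hz := integral_squareWave_mul_trigPoly N hg
    rw [intervalIntegral.integral_of_le zero_le_one] at hz
    have hq : IntegrableOn (fun x : ℝ => (((q μ (x : UnitAddCircle)).toReal : ℝ) : ℂ))
      (Set.Ioc 0 1) := (integrableOn_q hw).ofReal
    simp_rw [mul_sub]
    rw [integral_sub (integrableOn_squareWave_mul (N := N) hq)
      (integrableOn_squareWave_mul (N := N) (continuous_coe_trigPoly hg).integrableOn_Ioc), hz,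
      sub_zero]
  rw [h0 hf, ← h0 (isTrigPoly_k (μ := μ) N), ← integral_squareWave_mul_q_sub_k hw N,
    ← integral_complex_ofReal]
  refine integral_congr_ae (Filter.Eventually.of_forall fun x => ?_)
  simp only
  rw [Complex.ofReal_mul, Complex.ofReal_sub]
  congr 2
  apply Complex.ext <;> simp [k_im]

theorem setIntegral_re_eq
    (hw : WeightIntegrable μ) {N : ℕ}
    {f : UnitAddCircle → ℂ} (hf : IsTrigPoly N f) :
    ∫ x in Set.Ioc (0 : ℝ) 1, squareWave N x *
      ((((q μ (x : UnitAddCircle)).toReal : ℝ) : ℂ) - f (x : UnitAddCircle)).re =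
      ∫ lam : Set.Ioi (0 : ℝ), errorTerm N lam ∂μ := by
  have h := congrArg Complex.re (integral_squareWave_mul_q_sub hw hf)
  rw [Complex.ofReal_re] at h
  rw [← h, ← RCLike.re_eq_complex_re,
    ← integral_re (integrableOn_squareWave_mul (integrableOn_q_sub hw hf))]
  refine integral_congr_ae (Filter.Eventually.of_forall fun x => ?_)
  simp

theorem squareWave_mul_re_le (N : ℕ) (x : ℝ) (z : ℂ) : squareWave N x * z.re ≤ ‖z‖ :=
  calc _ ≤ |squareWave N x * z.re| := le_abs_self _
    _ = |squareWave N x| * |z.re| := abs_mul _ _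
    _ ≤ 1 * ‖z‖ := mul_le_mul (abs_squareWave_le_one N x) (Complex.abs_re_le_norm z)
        (abs_nonneg _) zero_le_one
    _ = ‖z‖ := one_mul _

theorem integrableOn_squareWave_mul_re
    (hw : WeightIntegrable μ) {N : ℕ}
    {f : UnitAddCircle → ℂ} (hf : IsTrigPoly N f) :
    IntegrableOn (fun x => squareWave N x *
      ((((q μ (x : UnitAddCircle)).toReal : ℝ) : ℂ) - f (x : UnitAddCircle)).re)
      (Set.Ioc 0 1) := by
  refine (integrableOn_squareWave_mul (N := N) (integrableOn_q_sub hw hf)).re.congr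
    (Filter.Eventually.of_forall fun x => ?_)
  simp

/-- The lower bound, by duality with the square wave. -/
theorem errorTerm_le_setIntegral
    (hw : WeightIntegrable μ) {N : ℕ}
    {f : UnitAddCircle → ℂ} (hf : IsTrigPoly N f) :
    ∫ lam : Set.Ioi (0 : ℝ), errorTerm N lam ∂μ ≤ ∫ x in Set.Ioc (0 : ℝ) 1,
      ‖(((q μ (x : UnitAddCircle)).toReal : ℝ) : ℂ) - f (x : UnitAddCircle)‖ := by
  rw [← setIntegral_re_eq hw hf]
  exact integral_mono (integrableOn_squareWave_mul_re hw hf) (integrableOn_q_sub hw hf).norm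
    fun x => squareWave_mul_re_le N x _

theorem setIntegral_norm_q_sub_k
    (hw : WeightIntegrable μ) (N : ℕ) :
    ∫ x in Set.Ioc (0 : ℝ) 1,
      ‖(((q μ (x : UnitAddCircle)).toReal : ℝ) : ℂ) - k μ N (x : UnitAddCircle)‖ =
      ∫ lam : Set.Ioi (0 : ℝ), errorTerm N lam ∂μ := by
  rw [← integral_squareWave_mul_q_sub_k hw N]
  refine integral_congr_ae ?_
  filter_upwards [ae_mem_Ioo] with x hx
  have e : (((q μ (x : UnitAddCircle)).toReal : ℝ) : ℂ) - k μ N (x : UnitAddCircle) =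
      (((q μ (x : UnitAddCircle)).toReal - (k μ N (x : UnitAddCircle)).re : ℝ) : ℂ) := by
    apply Complex.ext <;> simp [k_im]
  rw [e, Complex.norm_real, Real.norm_eq_abs]
  refine le_antisymm ?_ ?_
  · rw [squareWave_mul_q_sub_k hw N hx, q_toReal_sub_k_re hw N hx]
    exact abs_integral_le_integral_abs
  · rw [← Real.norm_eq_abs, ← Complex.norm_real]
    exact squareWave_mul_re_le N x
      (((q μ (x : UnitAddCircle)).toReal - (k μ N (x : UnitAddCircle)).re : ℝ) : ℂ)

/-- Dominated convergence with the bound `abs_pReal_le`, uniform on compact subsets of `(0, 1)`. -/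
theorem continuousAt_q
    (hw : WeightIntegrable μ) {x : ℝ}
    (hx : x ∈ Set.Ioo (0 : ℝ) 1) :
    ContinuousAt (fun y : ℝ => (q μ (y : UnitAddCircle)).toReal) x := by
  obtain ⟨δ, hδ0, hδx, hδ1⟩ : ∃ δ, 0 < δ ∧ δ < x ∧ x < 1 - δ := by
    refine ⟨min x (1 - x) / 2, ?_, ?_, ?_⟩
    · have := lt_min hx.1 (sub_pos.2 hx.2)
      linarith
    · have := min_le_left x (1 - x)
      linarith [hx.1]
    · have := min_le_right x (1 - x)
      linarith [hx.2]
  have hev : ∀ᶠ y in nhds x, y ∈ Set.Ioo δ (1 - δ) := Ioo_mem_nhds hδx hδ1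
  have hc : ContinuousAt (fun y : ℝ => ∫ lam : Set.Ioi (0 : ℝ), pClosed lam y ∂μ) x := by
    refine continuousAt_of_dominated
      (bound := fun lam : Set.Ioi (0 : ℝ) => 4 / δ * ((lam : ℝ) / ((lam : ℝ) ^ 2 + 1))) ?_ ?_
      (hw.const_mul _)
      (Filter.Eventually.of_forall fun lam => (continuous_pClosed lam).continuousAt)
    · filter_upwards [hev] with y hy
      exact (integrable_pClosed hw ⟨hδ0.trans hy.1, by linarith [hy.2]⟩).1
    · filter_upwards [hev] with y hy
      refine Filter.Eventually.of_forall fun lam => ?_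
      rw [Real.norm_eq_abs, ← pReal_eq_pClosed lam.2 ⟨by linarith [hy.1], by linarith [hy.2]⟩]
      exact abs_pReal_le lam.2 hδ0 hy.1.le hy.2.le
  refine hc.congr ?_
  filter_upwards [hev] with y hy
  exact (q_toReal_eq hw ⟨by linarith [hy.1], by linarith [hy.2]⟩).symm

/-- An extremal trigonometric polynomial interpolates `q` at the nodes, where the square wave
changes sign. -/
theorem eq_q_of_node
    (hw : WeightIntegrable μ) {N : ℕ}
    {f : UnitAddCircle → ℂ} (hf : IsTrigPoly N f)
    (he : ∫ x in Set.Ioc (0 : ℝ) 1,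
      ‖(((q μ (x : UnitAddCircle)).toReal : ℝ) : ℂ) - f (x : UnitAddCircle)‖ =
      ∫ lam : Set.Ioi (0 : ℝ), errorTerm N lam ∂μ) {j : ℕ} (hj : j < 2 * N + 2) :
    f (node N j) = (((q μ (node N j : UnitAddCircle)).toReal : ℝ) : ℂ) := by
  have hM : (0 : ℝ) < 2 * N + 2 := by positivity
  set v : ℝ → ℂ := fun x => (((q μ (x : UnitAddCircle)).toReal : ℝ) : ℂ) - f (x : UnitAddCircle)
    with hv
  have hi1 : IntegrableOn (fun x => squareWave N x * (v x).re) (Set.Ioc 0 1) :=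
    integrableOn_squareWave_mul_re hw hf
  have hi2 : IntegrableOn (fun x => ‖v x‖) (Set.Ioc 0 1) := (integrableOn_q_sub hw hf).norm
  have hz : ∫ x in Set.Ioc (0 : ℝ) 1, (‖v x‖ - squareWave N x * (v x).re) = 0 := by
    rw [integral_sub hi2 hi1, he, setIntegral_re_eq hw hf, sub_self]
  have hae := (integral_eq_zero_iff_of_nonneg
    (fun x => sub_nonneg.2 (squareWave_mul_re_le N x (v x))) (hi2.sub hi1)).1 hz
  have hae' := (ae_restrict_iff' measurableSet_Ioc).1 hae
  have hnode := node_mem N hj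
  have hcv : ContinuousAt v (node N j) :=
    (Complex.continuous_ofReal.continuousAt.comp (continuousAt_q hw hnode)).sub
      (continuous_coe_trigPoly hf).continuousAt
  have hcn : ContinuousAt (fun x => ‖v x‖) (node N j) := hcv.norm
  have hcr : ContinuousAt (fun x => (v x).re) (node N j) :=
    Complex.continuous_re.continuousAt.comp hcv
  have hj1 : (j : ℝ) + 1 ≤ 2 * N + 2 := by exact_mod_cast hj
  have hl : (j / (2 * N + 2) : ℝ) < node N j := by unfold node; gcongr; linarith
  have hr : node N j < ((j + 1) / (2 * N + 2) : ℝ) := by unfold node; gcongr; linarith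
  -- `‖v‖ = squareWave * Re v` almost everywhere, hence `‖v‖ = ± Re v` at the node, by continuity
  -- from the left with one sign and from the right with the other
  have hL : ‖v (node N j)‖ - (-1) ^ j * (v (node N j)).re = 0 := by
    refine eq_zero_of_ae_Ioo (g := fun x => ‖v x‖ - (-1) ^ j * (v x).re) hl
      (Set.right_mem_Icc.2 hl.le) (hcn.sub (continuousAt_const.mul hcr)) ?_
    filter_upwards [hae'] with x hx hxm
    have h0 : (0 : ℝ) ≤ j / (2 * N + 2) := by positivity
    have := hx ⟨h0.trans_lt hxm.1, (hxm.2.trans hnode.2).le⟩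
    rw [squareWave_left_of_node N j hxm] at this
    exact this
  have hR : ‖v (node N j)‖ - -(-1) ^ j * (v (node N j)).re = 0 := by
    refine eq_zero_of_ae_Ioo (g := fun x => ‖v x‖ - -(-1) ^ j * (v x).re) hr
      (Set.left_mem_Icc.2 hr.le) (hcn.sub (continuousAt_const.mul hcr)) ?_
    filter_upwards [hae'] with x hx hxm
    have h1 : ((j + 1) / (2 * N + 2) : ℝ) ≤ 1 := (div_le_one hM).2 hj1
    have := hx ⟨hnode.1.trans hxm.1, (hxm.2.le.trans h1)⟩
    rw [squareWave_right_of_node N j hxm] at this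
    exact this
  have h0 : ‖v (node N j)‖ = 0 := by linarith
  exact (sub_eq_zero.1 (norm_eq_zero.1 h0)).symm

theorem sign_integral_eq {x : ℝ} (N : ℕ) (hμ : μ ≠ 0)
    (hi : Integrable (fun lam : Set.Ioi (0 : ℝ) => pReal lam x - interpPoly N lam x) μ) :
    SignType.sign (∫ lam : Set.Ioi (0 : ℝ), (pReal lam x - interpPoly N lam x) ∂μ) =
      SignType.sign (Real.cos (Real.pi * (2 * N + 2) * x)) := by
  choose R hR e using fun lam : Set.Ioi (0 : ℝ) => pReal_sub_interpPoly N lam.2 x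
  simp_rw [e] at hi ⊢
  rw [integral_const_mul, sign_mul]
  by_cases hc : Real.cos (Real.pi * (2 * N + 2) * x) = 0
  · simp [hc]
  · have hRi : Integrable R μ := by
      have := hi.const_mul (Real.cos (Real.pi * (2 * N + 2) * x))⁻¹
      simpa [← mul_assoc, inv_mul_cancel₀ hc] using this
    have hpos : 0 < ∫ lam, R lam ∂μ := by
      rw [integral_pos_iff_support_of_nonneg (fun lam => (hR lam).le) hRi]
      have : Function.support R = Set.univ := by
        ext lam
        simp [(hR lam).ne']
      rw [this]
      exact Measure.measure_univ_pos.2 hμ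
    rw [sign_pos hpos, mul_one]

/-- Equivalent to `tanh (lam / 2) ≤ lam / 2`. -/
theorem pReal_zero_nonneg {lam : ℝ} (h : 0 < lam) : 0 ≤ pReal lam 0 := by
  have hE : 0 < 1 - Real.exp (-lam) := by
    have : Real.exp (-lam) < 1 := by rw [Real.exp_lt_one_iff]; linarith
    linarith
  have hsh := sinh_le_mul_cosh (half_pos h).le
  rw [pReal_eq h le_rfl zero_le_one]
  have h1 : 2 / lam ≤
      (Real.exp (-lam * 0) + Real.exp (-lam * (1 - 0))) / (1 - Real.exp (-lam)) := by
    rw [div_le_div_iff₀ h hE]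
    rw [Real.sinh_eq, Real.cosh_eq] at hsh
    have hm := mul_le_mul_of_nonneg_left hsh (Real.exp_pos (-(lam / 2))).le
    have e1 : Real.exp (-(lam / 2)) * Real.exp (lam / 2) = 1 := by
      rw [← Real.exp_add]; simp
    have e2 : Real.exp (-(lam / 2)) * Real.exp (-(lam / 2)) = Real.exp (-lam) := by
      rw [← Real.exp_add]; ring_nf
    simp only [mul_zero, Real.exp_zero, sub_zero, mul_one]
    have hl : Real.exp (-(lam / 2)) * ((Real.exp (lam / 2) - Real.exp (-(lam / 2))) / 2) =
        (1 - Real.exp (-lam)) / 2 := by rw [← e1, ← e2]; ring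
    have hr : Real.exp (-(lam / 2)) *
        (lam / 2 * ((Real.exp (lam / 2) + Real.exp (-(lam / 2))) / 2)) =
        lam / 2 * ((1 + Real.exp (-lam)) / 2) := by rw [← e1, ← e2]; ring
    rw [hl, hr] at hm
    linarith
  linarith

/-- When the integral defining `q` diverges, the point is an integer and `q = ∞`. -/
theorem q_eq_top
    (hw : WeightIntegrable μ) {x : ℝ}
    (hx : ¬ Integrable (fun lam : Set.Ioi (0 : ℝ) => pReal lam x) μ) :
    Int.fract x = 0 ∧ q μ (x : UnitAddCircle) = ⊤ := by
  have hf : Int.fract x = 0 := by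
    by_contra hne
    exact hx (integrable_pReal hw hne)
  refine ⟨hf, ?_⟩
  have hnn : ∀ lam : Set.Ioi (0 : ℝ), 0 ≤ pReal lam x := fun lam => by
    rw [← pReal_fract, hf]; exact pReal_zero_nonneg lam.2
  have h1 : ∫⁻ lam : Set.Ioi (0 : ℝ), ENNReal.ofReal (p lam (x : UnitAddCircle)) ∂μ = ⊤ := by
    by_contra hne
    exact hx ((lintegral_ofReal_ne_top_iff_integrable (aestronglyMeasurable_pReal x)
      (Filter.Eventually.of_forall hnn)).1 hne)
  have h2 : ∫⁻ lam : Set.Ioi (0 : ℝ), ENNReal.ofReal (-p lam (x : UnitAddCircle)) ∂μ = 0 := by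
    rw [lintegral_eq_zero_of_ae_eq_zero]
    exact Filter.Eventually.of_forall fun lam =>
      ENNReal.ofReal_of_nonpos (neg_nonpos.2 (hnn lam))
  rw [q, extIntegral, h1, h2]
  simp

end Measure

end

end PeriodicL1

theorem theorem6p2 (N : ℕ) (μ : MeasureTheory.Measure (Set.Ioi (0 : ℝ)))
    (hμ : ∫⁻ lam : Set.Ioi (0 : ℝ), ENNReal.ofReal ((lam : ℝ) / ((lam : ℝ) ^ 2 + 1)) ∂μ < ⊤) :
    -- the objects are well defined: the integral defining `q` converges off `0`,
    -- `q` is integrable on `ℝ / ℤ`, and the error is a convergent integral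
    (∀ x : UnitAddCircle, x ≠ 0 →
      MeasureTheory.Integrable (fun lam : Set.Ioi (0 : ℝ) => PeriodicL1.p lam x) μ) ∧
    MeasureTheory.Integrable (fun x : UnitAddCircle => (PeriodicL1.q μ x).toReal) ∧
    MeasureTheory.Integrable (fun lam : Set.Ioi (0 : ℝ) => PeriodicL1.errorTerm N lam) μ ∧
    PeriodicL1.IsTrigPoly N (PeriodicL1.k μ N) ∧
    -- the lower bound, with equality exactly for `k`
    (∀ f : UnitAddCircle → ℂ, PeriodicL1.IsTrigPoly N f →
      (∫ lam : Set.Ioi (0 : ℝ), PeriodicL1.errorTerm N lam ∂μ) ≤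
          ∫ x : UnitAddCircle, ‖(((PeriodicL1.q μ x).toReal : ℝ) : ℂ) - f x‖ ∧
      ((∫ x : UnitAddCircle, ‖(((PeriodicL1.q μ x).toReal : ℝ) : ℂ) - f x‖) =
          ∫ lam : Set.Ioi (0 : ℝ), PeriodicL1.errorTerm N lam ∂μ ↔
        f = PeriodicL1.k μ N)) ∧
    -- `k` is real valued
    (∀ x : UnitAddCircle, (PeriodicL1.k μ N x).im = 0) ∧
    -- the sign of the difference
    (μ ≠ 0 → ∀ x : ℝ,
      SignType.sign (Real.cos (Real.pi * (2 * N + 2) * x)) =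
        SignType.sign (PeriodicL1.q μ (x : UnitAddCircle) -
          (((PeriodicL1.k μ N (x : UnitAddCircle)).re : ℝ) : EReal))) := by
  open PeriodicL1 in
  have hw := integrable_weight hμ
  have hcirc : ∀ f : UnitAddCircle → ℂ,
      ∫ x : UnitAddCircle, ‖(((q μ x).toReal : ℝ) : ℂ) - f x‖ =
      ∫ x in Set.Ioc (0 : ℝ) 1,
        ‖(((q μ (x : UnitAddCircle)).toReal : ℝ) : ℂ) - f (x : UnitAddCircle)‖ := by
    intro f
    rw [← UnitAddCircle.integral_preimage 0, zero_add]
  refine ⟨fun x hx => ?_, integrable_q hw, integrable_errorTerm hw N, isTrigPoly_k N,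
    fun f hf => ⟨?_, ?_, ?_⟩, fun x => ?_, fun hne x => ?_⟩
  · obtain ⟨y, rfl⟩ := QuotientAddGroup.mk_surjective x
    refine integrable_pReal hw (x := y) fun h0 => hx ?_
    have hy : y = (⌊y⌋ : ℝ) := by
      have := Int.floor_add_fract y
      rw [h0, add_zero] at this
      exact this.symm
    exact (AddCircle.coe_eq_zero_iff 1).2 ⟨⌊y⌋, by rw [zsmul_one, ← hy]⟩
  · rw [hcirc]
    exact errorTerm_le_setIntegral hw hf
  · intro he
    rw [hcirc] at he
    refine isTrigPoly_eq_of_node hf (isTrigPoly_k N) fun j hj => ?_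
    rw [eq_q_of_node hw hf he hj,
      eq_q_of_node hw (isTrigPoly_k N) (setIntegral_norm_q_sub_k hw N) hj]
  · rintro rfl
    rw [hcirc, setIntegral_norm_q_sub_k hw N]
  · obtain ⟨y, rfl⟩ := QuotientAddGroup.mk_surjective x
    exact k_im N y
  · by_cases hx : MeasureTheory.Integrable (fun lam : Set.Ioi (0 : ℝ) => pReal lam x) μ
    · have hi := integrable_interpPoly hw N x
      rw [q_eq hx, k_re hw, ← EReal.coe_sub, ← MeasureTheory.integral_sub hx hi, EReal.sign_coe,
        sign_integral_eq N hne (hx.sub hi)]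
    · obtain ⟨h0, hq⟩ := q_eq_top hw hx
      have hxf : x = 0 + (⌊x⌋ : ℝ) := by
        have := Int.floor_add_fract x
        rw [h0] at this
        linarith
      have hc : Real.cos (Real.pi * (2 * N + 2) * x) = 1 := by
        rw [hxf, mul_assoc, cos_pi_mul_add_int, mul_zero, Real.cos_zero]
      rw [hq, EReal.top_sub_coe, hc, sign_pos one_pos, sign_pos EReal.zero_lt_top]
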